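/- Fix an integer $r\ge 2$. An instance of Test-$r$-Cover$(n-k)$ is a triple $(V,\mathcal{E},k)$, where $V$ is a finite set of vertices, $\mathcal{E}$ is a set of subsets of $V$ (edges), each with at most $r$ vertices, and $k\ge 1$ is an integer (the parameter). An edge $e$ separates two distinct vertices $x,y$ if $|\{x,y\}\cap e|=1$; a set $\mathcal{T}\subseteq\mathcal{E}$ is a test cover if every two distinct vertices of $V$ are separated by some edge of $\mathcal{T}$. It is assumed that $\mathcal{E}$ itself is a test cover. The question is whether there is a test cover $\mathcal{T}\subseteq\mathcal{E}$ with $|\mathcal{T}|\le |V|-k$. Theorem. For every fixed $r\ge 2$ there is a polynomial-time algorithm (polynomial in the length of the description of the instance) that maps every instance $(V,\mathcal{E},k)$ of Test-$r$-Cover$(n-k)$ to an instance $(V',\mathcal{E}',k)$ of Test-$r$-Cover$(n-k)$, with the same $k$, such that 1. the answer to $(V',\mathcal{E}',k)$ is Yes if and only if the answer to $(V,\mathcal{E},k)$ is Yes; 2. $|V'|\le 18k^3r$; 3. $|\mathcal{E}'|\le (18k^3r)^r$. In particular, Test-$r$-Cover$(n-k)$ admits a kernel of size polynomial in $k$. 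-/

import Mathlib

namespace TestCover

/-! ### Computation: while-programs on binary trees, with running time -/

/-- Binary trees (S-expressions with one atom), the data on which programs work. -/
inductive Data : Type
  | nil : Data
  | node : Data → Data → Data

namespace Data

/-- The number of nodes of a tree, leaves included. -/
def size : Data → ℕ
  | nil => 1
  | node a b => a.size + b.size + 1

/-- The left subtree (the atom has itself as left subtree). -/
def left : Data → Data
  | nil => nil
  | node a _ => a

/-- The right subtree (the atom has itself as right subtree). -/
def right : Data → Data
  | nil => nil
  | node _ b => b

def ofBool : Bool → Data
  | false => nil
  | true => node nil nil

/-- A list is represented in the usual way by its head and its tail. -/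
def ofList {α : Type} (f : α → Data) : List α → Data
  | [] => nil
  | a :: l => node (f a) (ofList f l)

/-- Natural numbers are written in binary. -/
def ofNat (n : ℕ) : Data := ofList ofBool n.bits

end Data

/-- Programs: a program maps a tree to a tree. -/
inductive Prog : Type
  | skip : Prog
  | nil : Prog
  | left : Prog
  | right : Prog
  | pair : Prog → Prog → Prog
  | seq : Prog → Prog → Prog
  | cond : Prog → Prog → Prog → Prog
  | loop : Prog → Prog → Prog

/-- `Run p x y t`: on input `x` the program `p` halts with output `y`, and its running time is `t`.
In `cond c p q` and `loop c p` the test succeeds if the output of `c` is not `nil`;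
`loop c p` means "while `c` succeeds, apply `p`".
Each time a program or subprogram is started (and each time the test of a loop is made), the whole
size of the tree to which it is applied is charged. So neither copying nor sharing of data is free,
and a run of cost `t` is simulated by a Turing machine in time polynomial in `t`. -/
inductive Run : Prog → Data → Data → ℕ → Prop
  | skip (x : Data) : Run .skip x x x.size
  | nil (x : Data) : Run .nil x .nil x.size
  | left (x : Data) : Run .left x x.left x.size
  | right (x : Data) : Run .right x x.right x.size
  | pair {p q : Prog} {x y z : Data} {s t : ℕ} :
      Run p x y s → Run q x z t → Run (.pair p q) x (.node y z) (x.size + s + t)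
  | seq {p q : Prog} {x y z : Data} {s t : ℕ} :
      Run p x y s → Run q y z t → Run (.seq p q) x z (x.size + s + t)
  | cond_true {c p q : Prog} {x b y : Data} {s t : ℕ} :
      Run c x b s → b ≠ .nil → Run p x y t → Run (.cond c p q) x y (x.size + s + t)
  | cond_false {c p q : Prog} {x y : Data} {s t : ℕ} :
      Run c x .nil s → Run q x y t → Run (.cond c p q) x y (x.size + s + t)
  | loop_done {c p : Prog} {x : Data} {s : ℕ} :
      Run c x .nil s → Run (.loop c p) x x (x.size + s)
  | loop_step {c p : Prog} {x b y z : Data} {s t u : ℕ} :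
      Run c x b s → b ≠ .nil → Run p x y t → Run (.loop c p) y z u →
        Run (.loop c p) x z (x.size + s + t + u)

/-! ### Test covers -/

/-- The edge `e` separates the (distinct) vertices `x` and `y`. -/
def Separates (e : Finset ℕ) (x y : ℕ) : Prop :=
  (({x, y} : Finset ℕ) ∩ e).card = 1

/-- The set `T` of edges is a test cover of the vertex set `V`. -/
def IsTestCover (V : Finset ℕ) (T : Finset (Finset ℕ)) : Prop :=
  ∀ x ∈ V, ∀ y ∈ V, x ≠ y → ∃ e ∈ T, Separates e x y

/-- An instance of Test-`r`-Cover(`n - k`): a finite hypergraph `(V, E)` (with natural numbers as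
vertex names) in which every edge has at most `r` vertices and the set of all edges is a test
cover, together with a parameter `k ≥ 1`. -/
structure Problem (r : ℕ) where
  V : Finset ℕ
  E : Finset (Finset ℕ)
  k : ℕ
  edge_subset : ∀ e ∈ E, e ⊆ V
  edge_card_le : ∀ e ∈ E, e.card ≤ r
  isTestCover : IsTestCover V E
  one_le_k : 1 ≤ k

namespace Problem

/-- The question: is there a test cover with at most `n - k` edges, where `n = |V|`?
(The bound is an integer, and negative if `k > n`.) -/
def IsYes {r : ℕ} (I : Problem r) : Prop :=
  ∃ T ⊆ I.E, IsTestCover I.V T ∧ (T.card : ℤ) ≤ (I.V.card : ℤ) - (I.k : ℤ)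

/-- The tree `d` is a description of the instance `I`: it consists of a list of the vertices, a
list of the edges, each of them given as a list of vertices, and the number `k`. The lists are
without repetitions and in any order. All numbers are in binary. -/
def IsCode {r : ℕ} (I : Problem r) (d : Data) : Prop :=
  ∃ (vs : List ℕ) (es : List (List ℕ)),
    vs.Nodup ∧ vs.toFinset = I.V ∧
    (∀ e ∈ es, e.Nodup) ∧ (es.map List.toFinset).Nodup ∧
    (es.map List.toFinset).toFinset = I.E ∧
    d = .node (Data.ofList Data.ofNat vs)
      (.node (Data.ofList (Data.ofList Data.ofNat) es) (Data.ofNat I.k))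

end Problem

end TestCover

namespace TestCover

/-! ### Polynomial-time computable functions -/

/-! For a set F of edges, compare |F| with the number `cls V F` of classes of vertices that F leaves
together. Since E is a test cover, F can be completed by edges each of which adds a class, so the
answer is Yes iff some F ⊆ E has |F| + k ≤ `cls V F` (`exists_isTestCover_iff`). At most 2k - 2
edges suffice for such an F (`exists_small_subset`): when no one or two further edges gain more
classes than edges, every edge cuts at most one class and no two cut a class into four, and such
edges gain at most one class each (`cls_union_le_of_compatible`).

The kernel starts from a greedy F with |F| ≤ 2k, extended by one or two edges at a time while they
gain more classes than edges. If F reaches |F| + k classes, the answer is Yes, and representatives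
of the classes with the traces of F form a small Yes-instance. Otherwise F has fewer than 3k classes
and is locally maximal. The vertices outside F form one class `rest V F`. If it is large, the edges
that meet it cut no other class and have laminar traces on it (`LocallyMaximal.laminar`), so its
vertices that lie in edges fall into components of at most r vertices.

The edges meeting a component separate certain pairs of classes. If for every such pair the
components with an edge separating it have together at least 4kr vertices, the component can be
removed: a solution with at most 2k - 2 edges makes up for its edges through the component by edges
through components not yet touched (`exists_fresh`, `exists_avoiding`). If no component is
removable, each lies in one of fewer than (3k)²/2 sets of fewer than 4kr vertices, which bounds |V|
(`LocallyMaximal.card_lt`). The running time comes from closure properties of `PolyTime`, above all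
under folds with polynomially bounded accumulators. -/

theorem Data.size_pos (x : Data) : 0 < x.size := by
  cases x <;> simp [Data.size]

theorem Data.size_left_le (x : Data) : x.left.size ≤ x.size := by
  cases x <;> simp [Data.size, Data.left]; omega

theorem Data.size_right_le (x : Data) : x.right.size ≤ x.size := by
  cases x <;> simp [Data.size, Data.right]; omega

/-- The output of a program is no larger than its running time. -/
theorem Run.size_le {p : Prog} {x y : Data} {t : ℕ} (h : Run p x y t) : y.size ≤ t := by
  induction h with
  | skip x => exact le_rfl
  | nil x => exact x.size_pos
  | left x => exact x.size_left_le
  | right x => exact x.size_right_le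
  | @pair p q x y z s t _ _ h1 h2 => have := x.size_pos; simp only [Data.size]; omega
  | _ => omega

/-- On input `x` the program `p` halts with output `y` within time `n`. -/
def RunsIn (p : Prog) (x y : Data) (n : ℕ) : Prop := ∃ t ≤ n, Run p x y t

namespace RunsIn

variable {p q c : Prog} {x y z b : Data} {m n k : ℕ}

theorem mono (h : RunsIn p x y m) (hmn : m ≤ n) : RunsIn p x y n :=
  let ⟨t, ht, hr⟩ := h; ⟨t, ht.trans hmn, hr⟩

theorem size_le (h : RunsIn p x y m) : y.size ≤ m :=
  let ⟨_, ht, hr⟩ := h; hr.size_le.trans ht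

theorem skip : RunsIn .skip x x x.size := ⟨_, le_rfl, .skip x⟩
theorem nil : RunsIn .nil x .nil x.size := ⟨_, le_rfl, .nil x⟩
theorem left : RunsIn .left x x.left x.size := ⟨_, le_rfl, .left x⟩
theorem right : RunsIn .right x x.right x.size := ⟨_, le_rfl, .right x⟩

theorem pair (h : RunsIn p x y m) (h' : RunsIn q x z n) :
    RunsIn (.pair p q) x (.node y z) (x.size + m + n) :=
  let ⟨s, hs, hr⟩ := h; let ⟨t, ht, hr'⟩ := h'; ⟨x.size + s + t, by omega, .pair hr hr'⟩

theorem seq (h : RunsIn p x y m) (h' : RunsIn q y z n) :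
    RunsIn (.seq p q) x z (x.size + m + n) :=
  let ⟨s, hs, hr⟩ := h; let ⟨t, ht, hr'⟩ := h'; ⟨x.size + s + t, by omega, .seq hr hr'⟩

theorem cond_true (h : RunsIn c x b m) (hb : b ≠ .nil) (h' : RunsIn p x y n) :
    RunsIn (.cond c p q) x y (x.size + m + n) :=
  let ⟨s, hs, hr⟩ := h; let ⟨t, ht, hr'⟩ := h'; ⟨x.size + s + t, by omega, .cond_true hr hb hr'⟩

theorem cond_false (h : RunsIn c x .nil m) (h' : RunsIn q x y n) :
    RunsIn (.cond c p q) x y (x.size + m + n) :=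
  let ⟨s, hs, hr⟩ := h; let ⟨t, ht, hr'⟩ := h'; ⟨x.size + s + t, by omega, .cond_false hr hr'⟩

theorem loop_done (h : RunsIn c x .nil m) : RunsIn (.loop c p) x x (x.size + m) :=
  let ⟨s, hs, hr⟩ := h; ⟨x.size + s, by omega, .loop_done hr⟩

theorem loop_step (h : RunsIn c x b m) (hb : b ≠ .nil) (h' : RunsIn p x y n)
    (h'' : RunsIn (.loop c p) y z k) : RunsIn (.loop c p) x z (x.size + m + n + k) :=
  let ⟨s, hs, hr⟩ := h; let ⟨t, ht, hr'⟩ := h'; let ⟨u, hu, hr''⟩ := h''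
  ⟨x.size + s + t + u, by omega, .loop_step hr hb hr' hr''⟩

end RunsIn

/-- Types whose elements are represented by trees. -/
class Enc (α : Type) where
  enc : α → Data

open Enc

instance : Enc Bool := ⟨Data.ofBool⟩
instance : Enc ℕ := ⟨Data.ofNat⟩
instance {α : Type} [Enc α] : Enc (List α) := ⟨Data.ofList enc⟩
instance {α β : Type} [Enc α] [Enc β] : Enc (α × β) := ⟨fun z => .node (enc z.1) (enc z.2)⟩

theorem foldl_cons {α : Type} (l m : List α) :
    l.foldl (fun acc a => a :: acc) m = l.reverse ++ m := by
  induction l generalizing m with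
  | nil => rfl
  | cons a l ih => simp [ih]

/-- Comparison of the lengths of two lists. -/
def lenLe {α β : Type} (l : List α) (m : List β) : Bool := (m.foldl (fun acc _ => acc.tail) l).isEmpty

theorem lenLe_iff {α β : Type} {l : List α} {m : List β} : lenLe l m = true ↔ l.length ≤ m.length := by
  have : ∀ (m : List β) (l : List α), m.foldl (fun acc _ => acc.tail) l = l.drop m.length := by
    intro m
    induction m with
    | nil => simp
    | cons a m ih => intro l; simp [ih]
  simp [lenLe, this]

/-! ### Sizes of encodings and the notion of polynomial time. -/

section

variable {α β γ δ : Type} [Enc α] [Enc β] [Enc γ] [Enc δ]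

/-- The size of the representation of an element. -/
def sz (a : α) : ℕ := (enc a).size

theorem sz_pos (a : α) : 0 < sz a := Data.size_pos _
theorem sz_prod (a : α) (b : β) : sz (a, b) = sz a + sz b + 1 := rfl
theorem sz_nil : sz ([] : List α) = 1 := rfl
theorem sz_cons (a : α) (l : List α) : sz (a :: l) = sz a + sz l + 1 := rfl
theorem sz_bool_le (b : Bool) : sz b ≤ 3 := by cases b <;> decide

theorem sz_append (l m : List α) : sz (l ++ m) + 1 = sz l + sz m := by
  induction l with
  | nil => simp [sz_nil, add_comm]
  | cons a l ih => simp only [List.cons_append, sz_cons]; omega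

theorem sz_le_of_mem {a : α} {l : List α} (h : a ∈ l) : sz a < sz l := by
  induction l with
  | nil => simp at h
  | cons b l ih =>
    rcases List.mem_cons.1 h with rfl | h
    · rw [sz_cons]; omega
    · have := ih h; rw [sz_cons]; omega

theorem length_lt_sz (l : List α) : l.length < sz l := by
  induction l with
  | nil => exact sz_pos _
  | cons b l ih => rw [sz_cons, List.length_cons]; omega

theorem sz_sublist {l m : List α} (h : l.Sublist m) : sz l ≤ sz m := by
  induction h with
  | slnil => exact le_rfl
  | cons a _ ih => rw [sz_cons]; omega
  | cons_cons a _ ih => rw [sz_cons, sz_cons]; omega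

theorem eval_mono (q : Polynomial ℕ) {m n : ℕ} (h : m ≤ n) : q.eval m ≤ q.eval n := by
  rw [Polynomial.eval_eq_sum_range, Polynomial.eval_eq_sum_range]
  gcongr

/-- The function `f` is computed by a program in polynomial time. -/
def PolyTime (f : α → β) : Prop :=
  ∃ (p : Prog) (q : Polynomial ℕ), ∀ a, RunsIn p (enc a) (enc (f a)) (q.eval (sz a))

/-! ### Closure of polynomial time under composition, branching and folds. -/

namespace PolyTime

theorem sz_le {f : α → β} (hf : PolyTime f) : ∃ q : Polynomial ℕ, ∀ a, sz (f a) ≤ q.eval (sz a) :=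
  let ⟨_, q, h⟩ := hf; ⟨q, fun a => (h a).size_le⟩

theorem id : PolyTime fun a : α => a := ⟨.skip, .X, fun a => RunsIn.skip.mono (by simp [sz])⟩

/-- A function that merely reads the representation of its argument as a value of another type. -/
theorem of_enc_eq {f : α → β} (h : ∀ a, enc (f a) = enc a) : PolyTime f :=
  ⟨.skip, .X, fun a => by rw [h]; exact RunsIn.skip.mono (by simp [sz])⟩

theorem comp {f : α → β} {g : β → γ} (hg : PolyTime g) (hf : PolyTime f) :
    PolyTime fun a => g (f a) := by
  obtain ⟨p, q, h⟩ := hf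
  obtain ⟨p', q', h'⟩ := hg
  refine ⟨.seq p p', .X + q + q'.comp q, fun a => ((h a).seq (h' (f a))).mono ?_⟩
  have := eval_mono q' (h a).size_le
  simp only [Polynomial.eval_add, Polynomial.eval_X, Polynomial.eval_comp]
  exact Nat.add_le_add_left this _

theorem fst {f : α → β × γ} (hf : PolyTime f) : PolyTime fun a => (f a).1 :=
  comp (g := Prod.fst) ⟨.left, .X, fun _ => RunsIn.left.mono (by simp [sz])⟩ hf

theorem snd {f : α → β × γ} (hf : PolyTime f) : PolyTime fun a => (f a).2 :=
  comp (g := Prod.snd) ⟨.right, .X, fun _ => RunsIn.right.mono (by simp [sz])⟩ hf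

theorem prod {f : α → β} {g : α → γ} (hf : PolyTime f) (hg : PolyTime g) :
    PolyTime fun a => (f a, g a) := by
  obtain ⟨p, q, h⟩ := hf
  obtain ⟨p', q', h'⟩ := hg
  exact ⟨.pair p p', .X + q + q', fun a => ((h a).pair (h' a)).mono (by simp [sz])⟩

theorem cons {f : α → β} {g : α → List β} (hf : PolyTime f) (hg : PolyTime g) :
    PolyTime fun a => f a :: g a := by
  obtain ⟨p, q, h⟩ := hf
  obtain ⟨p', q', h'⟩ := hg
  exact ⟨.pair p p', .X + q + q', fun a => ((h a).pair (h' a)).mono (by simp [sz])⟩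

theorem nil : PolyTime fun _ : α => ([] : List β) :=
  ⟨.nil, .X, fun _ => RunsIn.nil.mono (by simp [sz])⟩

theorem false : PolyTime fun _ : α => Bool.false :=
  ⟨.nil, .X, fun _ => RunsIn.nil.mono (by simp [sz])⟩

theorem true : PolyTime fun _ : α => Bool.true :=
  ⟨.pair .nil .nil, .X + .X + .X, fun _ => (RunsIn.nil.pair RunsIn.nil).mono (by simp [sz])⟩

theorem tail {f : α → List β} (hf : PolyTime f) : PolyTime fun a => (f a).tail := by
  refine comp (g := List.tail) ⟨.right, .X, fun l => ?_⟩ hf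
  cases l <;> exact RunsIn.right.mono (by simp [sz])

/-- The head of a list, for types whose default element is represented by the atom. -/
theorem headI [Inhabited β] (hd : enc (default : β) = .nil) {f : α → List β} (hf : PolyTime f) :
    PolyTime fun a => (f a).headI := by
  refine comp (g := List.headI) ⟨.left, .X, fun l => ?_⟩ hf
  cases l with
  | nil => rw [List.headI_nil, hd]; exact RunsIn.left.mono (by simp [sz])
  | cons b l => exact RunsIn.left.mono (by simp [sz])

theorem cond {b : α → Bool} {f g : α → β} (hb : PolyTime b) (hf : PolyTime f) (hg : PolyTime g) :
    PolyTime fun a => bif b a then f a else g a := by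
  obtain ⟨p₀, q₀, h₀⟩ := hb
  obtain ⟨p, q, h⟩ := hf
  obtain ⟨p', q', h'⟩ := hg
  refine ⟨.cond p₀ p p', .X + q₀ + (q + q'), fun a => ?_⟩
  have h1 := h₀ a
  change RunsIn _ _ (enc (bif b a then f a else g a)) _
  cases hba : b a
  · rw [hba] at h1
    refine (h1.cond_false (h' a)).mono ?_
    simp only [Polynomial.eval_add, Polynomial.eval_X, sz]; omega
  · rw [hba] at h1
    refine (h1.cond_true Data.noConfusion (h a)).mono ?_
    simp only [Polynomial.eval_add, Polynomial.eval_X, sz]; omega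

theorem isEmpty {f : α → List β} (hf : PolyTime f) : PolyTime fun a => (f a).isEmpty := by
  refine comp (g := List.isEmpty)
    ⟨.cond .skip .nil (.pair .nil .nil), .X + .X + (.X + .X + .X), fun l => ?_⟩ hf
  cases l with
  | nil =>
    exact (RunsIn.skip (x := .nil).cond_false (RunsIn.nil.pair RunsIn.nil)).mono
      (by simp [sz, enc, Data.ofList])
  | cons b l =>
    exact (RunsIn.skip.cond_true Data.noConfusion RunsIn.nil).mono (by simp [sz])

theorem not {b : α → Bool} (hb : PolyTime b) : PolyTime fun a => !b a := by
  convert cond hb false true using 2 with a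
  cases b a <;> rfl

theorem and {b c : α → Bool} (hb : PolyTime b) (hc : PolyTime c) :
    PolyTime fun a => b a && c a := by
  convert cond hb hc false using 2 with a
  cases b a <;> rfl

theorem or {b c : α → Bool} (hb : PolyTime b) (hc : PolyTime c) :
    PolyTime fun a => b a || c a := by
  convert cond hb true hc using 2 with a
  cases b a <;> rfl

theorem xor {b c : α → Bool} (hb : PolyTime b) (hc : PolyTime c) :
    PolyTime fun a => Bool.xor (b a) (c a) := by
  convert cond hb (not hc) hc using 2 with a
  cases b a <;> simp

/-- The test of the loop that runs through a list; the state consists of the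
context, the accumulator and the remaining list. -/
def foldTest : Prog := .seq .right .right

/-- The body of the loop that runs through a list. -/
def foldBody (p : Prog) : Prog :=
  .pair .left (.pair (.seq (.pair .left (.pair (.seq .right .left)
    (.seq .right (.seq .right .left)))) p) (.seq .right (.seq .right .right)))

/-- Besides the step itself, a round is charged the sizes of a bounded number of trees of size at
most `S`; 30 is a generous count of them. -/
theorem runsIn_fold {s : γ → β → α → β} {p : Prog} {q : Polynomial ℕ}
    (hp : ∀ z : γ × β × α, RunsIn p (enc z) (enc (s z.1 z.2.1 z.2.2)) (q.eval (sz z)))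
    (c : γ) (S : ℕ) (l : List α) (b : β)
    (hS : ∀ m, m <+: l → sz c + sz (m.foldl (s c) b) + sz l + 2 ≤ S) :
    RunsIn (.loop foldTest (foldBody p)) (enc (c, b, l)) (enc (c, l.foldl (s c) b, ([] : List α)))
      ((l.length + 1) * (30 * S + q.eval S)) := by
  induction l generalizing b with
  | nil =>
    have h0 := hS [] (List.prefix_refl _)
    have h : RunsIn foldTest (enc (c, b, ([] : List α))) .nil _ := RunsIn.right.seq RunsIn.right
    refine h.loop_done.mono ?_
    have h1 : sz (c, b, ([] : List α)) ≤ S := by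
      rw [sz_prod, sz_prod]; simp only [List.foldl_nil] at h0; omega
    have h2 := Data.size_right_le (enc (c, b, ([] : List α)))
    simp only [sz, List.length_nil, zero_add, one_mul] at h1 ⊢
    omega
  | cons a l ih =>
    have h0 := hS [] List.nil_prefix
    simp only [List.foldl_nil] at h0
    have h1 : sz (c, b, a :: l) ≤ S := by rw [sz_prod, sz_prod]; omega
    have ht : RunsIn foldTest (enc (c, b, a :: l)) (enc (a :: l)) _ := RunsIn.right.seq RunsIn.right
    have ha : RunsIn (.seq .right (.seq .right .left)) (enc (c, b, a :: l)) (enc a) _ :=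
      RunsIn.right.seq (RunsIn.right.seq RunsIn.left)
    have hr : RunsIn (.seq .right (.seq .right .right)) (enc (c, b, a :: l)) (enc l) _ :=
      RunsIn.right.seq (RunsIn.right.seq RunsIn.right)
    have hb : RunsIn (.seq .right .left) (enc (c, b, a :: l)) (enc b) _ :=
      RunsIn.right.seq RunsIn.left
    have hc : RunsIn .left (enc (c, b, a :: l)) (enc c) _ := RunsIn.left
    have hbody : RunsIn (foldBody p) (enc (c, b, a :: l)) (enc (c, s c b a, l)) _ :=
      hc.pair (((hc.pair (hb.pair ha)).seq (hp (c, b, a))).pair hr)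
    have hi := ih (s c b a) fun m hm => by
      have := hS (a :: m) (List.cons_prefix_cons.2 ⟨rfl, hm⟩)
      rw [sz_cons] at this; simp only [List.foldl_cons] at this; omega
    refine (ht.loop_step Data.noConfusion hbody hi).mono ?_
    have h2 : (enc (c, b, a :: l)).size ≤ S := h1
    have h3 : (enc (c, b, a :: l)).right.size ≤ S := (Data.size_right_le _).trans h2
    have h4 : (enc (c, b, a :: l)).right.right.size ≤ S := (Data.size_right_le _).trans h3
    have h5 : (Data.node (enc c) (Data.node (enc b) (enc a))).size ≤ S := by
      have := sz_cons a l
      simp only [sz, Data.size] at h0 this ⊢; omega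
    have h6 : q.eval (sz (c, b, a)) ≤ q.eval S := eval_mono q h5
    rw [List.length_cons, add_mul (l.length + 1) 1]
    omega

/-- A polynomial-time step may double its accumulator, so iteration needs the bound `Q` on all
intermediate values. The polynomial `S` majorises the whole loop state. -/
theorem foldl {f : γ → List α} {i : γ → β} {s : γ → β → α → β} (hf : PolyTime f)
    (hi : PolyTime i) (hs : PolyTime fun z : γ × β × α => s z.1 z.2.1 z.2.2) (Q : Polynomial ℕ)
    (hQ : ∀ c m, m <+: f c → sz (m.foldl (s c) (i c)) ≤ Q.eval (sz c)) :
    PolyTime fun c => (f c).foldl (s c) (i c) := by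
  obtain ⟨pf, qf, hf⟩ := hf
  obtain ⟨pi, qi, hi⟩ := hi
  obtain ⟨p, q, hp⟩ := hs
  let S : Polynomial ℕ := .X + Q + qf + 2
  refine ⟨.seq (.pair .skip (.pair pi pf)) (.seq (.loop foldTest (foldBody p))
    (.seq .right .left)), .X + (.X + .X + (.X + qi + qf)) + ((.X + .X + (.X + qi + qf)) +
    (qf + 1) * (30 * S + q.comp S) + 3 * S), fun c => ?_⟩
  have h1 : RunsIn _ (enc c) (enc (c, i c, f c)) _ := RunsIn.skip.pair ((hi c).pair (hf c))
  have h2 := runsIn_fold hp c (S.eval (sz c)) (f c) (i c) fun m hm => by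
    have := hQ c m hm
    have h3 : sz (f c) ≤ _ := (hf c).size_le
    simp only [S, Polynomial.eval_add, Polynomial.eval_X, Polynomial.eval_ofNat]
    omega
  have h3 : RunsIn (.seq .right .left) (enc (c, (f c).foldl (s c) (i c), ([] : List α)))
    (enc ((f c).foldl (s c) (i c))) _ := RunsIn.right.seq RunsIn.left
  refine (h1.seq (h2.seq h3)).mono ?_
  have h4 := hQ c _ (List.prefix_refl _)
  have h5 : sz (c, (f c).foldl (s c) (i c), ([] : List α)) ≤ S.eval (sz c) := by
    rw [sz_prod, sz_prod, sz_nil]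
    have h3 : sz (f c) ≤ _ := (hf c).size_le
    have h6 := sz_pos (f c)
    simp only [S, Polynomial.eval_add, Polynomial.eval_X, Polynomial.eval_ofNat]
    omega
  have h6 := Data.size_right_le (enc (c, (f c).foldl (s c) (i c), ([] : List α)))
  have h7 : (f c).length + 1 ≤ qf.eval (sz c) + 1 :=
    Nat.add_le_add_right ((length_lt_sz _).le.trans (hf c).size_le) 1
  have h8 := Nat.mul_le_mul_right (30 * S.eval (sz c) + q.eval (S.eval (sz c))) h7
  have h9 := h1.size_le
  simp only [Polynomial.eval_add, Polynomial.eval_mul, Polynomial.eval_X, Polynomial.eval_ofNat,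
    Polynomial.eval_comp, Polynomial.eval_one]
  simp only [sz] at h5 h8 h9 ⊢
  omega

/-- A fold whose accumulator grows by a polynomially bounded amount in each step. -/
theorem foldl_add {f : γ → List α} {i : γ → β} {s : γ → β → α → β} (hf : PolyTime f)
    (hi : PolyTime i) (hs : PolyTime fun z : γ × β × α => s z.1 z.2.1 z.2.2) (Q : Polynomial ℕ)
    (hQ : ∀ c b, ∀ a ∈ f c, sz (s c b a) ≤ sz b + Q.eval (sz c)) :
    PolyTime fun c => (f c).foldl (s c) (i c) := by
  obtain ⟨qf, hqf⟩ := hf.sz_le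
  obtain ⟨qi, hqi⟩ := hi.sz_le
  refine foldl hf hi hs (qi + qf * Q) fun c m hm => ?_
  have key : ∀ (m : List α) b, (∀ a ∈ m, a ∈ f c) →
      sz (m.foldl (s c) b) ≤ sz b + m.length * Q.eval (sz c) := by
    intro m
    induction m with
    | nil => intro b _; simp
    | cons a m ih =>
      intro b hm
      have h1 := ih (s c b a) fun x hx => hm x (List.mem_cons_of_mem _ hx)
      have h2 := hQ c b a (hm a List.mem_cons_self)
      rw [List.foldl_cons, List.length_cons, add_mul, one_mul]
      omega
  have h1 := key m (i c) fun a ha => hm.subset ha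
  have h2 : m.length ≤ qf.eval (sz c) := hm.length_le.trans ((length_lt_sz _).le.trans (hqf c))
  have h3 := Nat.mul_le_mul_right (Q.eval (sz c)) h2
  have h4 := hqi c
  simp only [Polynomial.eval_add, Polynomial.eval_mul]
  omega

/-! ### List operations in polynomial time. -/

theorem reverseAppend {f g : γ → List α} (hf : PolyTime f) (hg : PolyTime g) :
    PolyTime fun c => (f c).reverse ++ g c := by
  obtain ⟨qf, hqf⟩ := hf.sz_le
  simp only [← foldl_cons]
  refine foldl_add hf hg (s := fun _ acc a => a :: acc) (cons id.snd.snd id.snd.fst) qf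
    fun c b a ha => ?_
  have := sz_le_of_mem ha
  have := hqf c
  rw [sz_cons]; omega

theorem reverse {f : γ → List α} (hf : PolyTime f) : PolyTime fun c => (f c).reverse := by
  simpa using reverseAppend hf nil

theorem append {f g : γ → List α} (hf : PolyTime f) (hg : PolyTime g) :
    PolyTime fun c => f c ++ g c := by
  simpa using reverseAppend (reverse hf) hg

theorem flatten {f : γ → List (List α)} (hf : PolyTime f) : PolyTime fun c => (f c).flatten := by
  obtain ⟨qf, hqf⟩ := hf.sz_le
  have key : ∀ (l : List (List α)) (m : List α), l.foldl (fun acc a => acc ++ a) m =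
      m ++ l.flatten := by
    intro l
    induction l with
    | nil => simp
    | cons a l ih => intro m; simp [ih]
  have := foldl_add hf nil (s := fun _ acc a => acc ++ a) (append id.snd.fst id.snd.snd) qf
    fun c b a ha => by
      have := sz_le_of_mem ha
      have := hqf c
      have := sz_append b a
      omega
  simpa only [key, List.nil_append] using this

theorem map {f : γ → List α} {g : γ → α → β} (hf : PolyTime f)
    (hg : PolyTime fun z : γ × α => g z.1 z.2) : PolyTime fun c => (f c).map (g c) := by
  obtain ⟨qf, hqf⟩ := hf.sz_le
  obtain ⟨qg, hqg⟩ := hg.sz_le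
  have key : ∀ (g : α → β) (l : List α) (m : List β), l.foldl (fun acc a => g a :: acc) m =
      (l.map g).reverse ++ m := by
    intro g l
    induction l with
    | nil => simp
    | cons a l ih => intro m; simp [ih]
  have hg' : PolyTime fun z : γ × List β × α => g z.1 z.2.2 :=
    comp (g := fun z : γ × α => g z.1 z.2) hg (prod id.fst id.snd.snd)
  have := foldl_add hf nil (s := fun c acc a => g c a :: acc) (cons hg' id.snd.fst)
    (qg.comp (.X + qf) + 1) fun c b a ha => by
      have h1 := sz_le_of_mem ha
      have h2 := hqf c
      have h3 : sz (g c a) ≤ _ := hqg (c, a)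
      have h4 : sz (c, a) ≤ sz c + qf.eval (sz c) := by rw [sz_prod]; omega
      have h5 := eval_mono qg h4
      simp only [Polynomial.eval_add, Polynomial.eval_comp, Polynomial.eval_X, Polynomial.eval_one]
      rw [sz_cons]; omega
  simpa only [key, List.append_nil, List.reverse_reverse] using reverse this

theorem filter {f : γ → List α} {g : γ → α → Bool} (hf : PolyTime f)
    (hg : PolyTime fun z : γ × α => g z.1 z.2) : PolyTime fun c => (f c).filter (g c) := by
  obtain ⟨qf, hqf⟩ := hf.sz_le
  have key : ∀ (g : α → Bool) (l m : List α),
      l.foldl (fun acc a => bif g a then a :: acc else acc) m = (l.filter g).reverse ++ m := by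
    intro g l
    induction l with
    | nil => simp
    | cons a l ih => intro m; cases h : g a <;> simp [ih, h]
  have hg' : PolyTime fun z : γ × List α × α => g z.1 z.2.2 :=
    comp (g := fun z : γ × α => g z.1 z.2) hg (prod id.fst id.snd.snd)
  have := foldl_add hf nil (s := fun c acc a => bif g c a then a :: acc else acc)
    (cond hg' (cons id.snd.snd id.snd.fst) id.snd.fst) qf fun c b a ha => by
      have h1 := sz_le_of_mem ha
      have h2 := hqf c
      cases g c a
      · simp
      · simp only [cond_true, sz_cons]; omega
  simpa only [key, List.append_nil, List.reverse_reverse] using reverse this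

theorem any {f : γ → List α} {g : γ → α → Bool} (hf : PolyTime f)
    (hg : PolyTime fun z : γ × α => g z.1 z.2) : PolyTime fun c => (f c).any (g c) := by
  have h : ∀ (g : α → Bool) (l : List α), l.any g = !(l.filter g).isEmpty := by
    intro g l
    induction l with
    | nil => rfl
    | cons a l ih => cases h : g a <;> simp [h, ih]
  simp only [h]
  exact not (isEmpty (filter hf hg))

theorem all {f : γ → List α} {g : γ → α → Bool} (hf : PolyTime f)
    (hg : PolyTime fun z : γ × α => g z.1 z.2) : PolyTime fun c => (f c).all (g c) := by
  simp only [List.all_eq_not_any_not]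
  exact not (any hf (not hg))

end PolyTime

namespace PolyTime

theorem lenLe {f : γ → List α} {g : γ → List β} (hf : PolyTime f) (hg : PolyTime g) :
    PolyTime fun c => lenLe (f c) (g c) := by
  refine isEmpty (foldl_add hg hf (s := fun _ acc _ => acc.tail) (tail id.snd.fst) 0
    fun c b a _ => ?_)
  exact (sz_sublist (List.tail_sublist b)).trans (Nat.le_add_right _ _)

end PolyTime

/-- Equality of lists of Booleans, tested in one pass. -/
def eqBits (l m : List Bool) : Bool :=
  let z := l.foldl (fun (s : Bool × List Bool) b =>
    (s.1 && (!s.2.isEmpty && !(Bool.xor s.2.headI b)), s.2.tail)) (true, m)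
  z.1 && z.2.isEmpty

theorem eqBits_iff {l m : List Bool} : eqBits l m = true ↔ l = m := by
  have : ∀ (l m : List Bool) (b : Bool),
      ((l.foldl (fun (s : Bool × List Bool) b =>
        (s.1 && (!s.2.isEmpty && !(Bool.xor s.2.headI b)), s.2.tail)) (b, m)).1 = true ∧
      (l.foldl (fun (s : Bool × List Bool) b =>
        (s.1 && (!s.2.isEmpty && !(Bool.xor s.2.headI b)), s.2.tail)) (b, m)).2 = []) ↔
      b = true ∧ l = m := by
    intro l
    induction l with
    | nil => simp [eq_comm]
    | cons a l ih =>
      intro m b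
      rw [List.foldl_cons, ih]
      cases m with
      | nil => simp
      | cons c m => cases a <;> cases b <;> cases c <;> simp
  simp [eqBits, this]

theorem foldr_bits (n : ℕ) : n.bits.foldr Nat.bit 0 = n := by
  induction n using Nat.binaryRec' with
  | zero => simp
  | bit b n h ih => rw [Nat.bits_append_bit n b h, List.foldr_cons, ih]

/-- Equality of numbers. -/
def eqNat (a b : ℕ) : Bool := eqBits a.bits b.bits

theorem eqNat_iff {a b : ℕ} : eqNat a b = true ↔ a = b := by
  rw [eqNat, eqBits_iff]
  refine ⟨fun h => ?_, fun h => h ▸ rfl⟩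
  rw [← foldr_bits a, ← foldr_bits b, h]

namespace PolyTime

theorem bits {f : γ → ℕ} (hf : PolyTime f) : PolyTime fun c => (f c).bits :=
  comp (g := Nat.bits) (of_enc_eq fun _ => rfl) hf

theorem eqNat {f g : γ → ℕ} (hf : PolyTime f) (hg : PolyTime g) :
    PolyTime fun c => eqNat (f c) (g c) := by
  obtain ⟨qg, hqg⟩ := (bits hg).sz_le
  have h := foldl (bits hf) (prod true (bits hg))
    (s := fun _ (s : Bool × List Bool) b =>
      (s.1 && (!s.2.isEmpty && !(Bool.xor s.2.headI b)), s.2.tail))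
    (prod (and id.snd.fst.fst (and (not (isEmpty id.snd.fst.snd))
      (not (xor (headI rfl id.snd.fst.snd) id.snd.snd)))) (tail id.snd.fst.snd)) (qg + 4)
    fun c m _ => ?_
  · exact and h.fst (isEmpty h.snd)
  -- The flag contributes at most 3 and the pair node 1, while the list only shrinks.
  · have key : ∀ (m l : List Bool) (b : Bool), sz (m.foldl (fun (s : Bool × List Bool) b =>
        (s.1 && (!s.2.isEmpty && !(Bool.xor s.2.headI b)), s.2.tail)) (b, l)) ≤ sz l + 4 := by
      intro m
      induction m with
      | nil => intro l b; have := sz_bool_le b; rw [List.foldl_nil, sz_prod]; omega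
      | cons a m ih =>
        intro l b
        rw [List.foldl_cons]
        exact (ih _ _).trans (Nat.add_le_add_right (sz_sublist (List.tail_sublist l)) 4)
    have := key m (g c).bits Bool.true
    have := hqg c
    simp only [Polynomial.eval_add, Polynomial.eval_ofNat]
    omega

end PolyTime
end

/-! ### Classes of vertices -/

/-- No edge of `F` separates `x` and `y`. -/
def Equiv (F : Finset (Finset ℕ)) (x y : ℕ) : Prop := ∀ e ∈ F, x ∈ e ↔ y ∈ e

/-- The number of classes into which `F` divides `V`. -/
def cls (V : Finset ℕ) (F : Finset (Finset ℕ)) : ℕ :=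
  (V.image fun v => F.filter (v ∈ ·)).card

section Classes

variable {V A S : Finset ℕ} {E F G D T : Finset (Finset ℕ)} {e : Finset ℕ} {x y z a b c d : ℕ}

theorem Equiv.refl (F : Finset (Finset ℕ)) (x : ℕ) : Equiv F x x := fun _ _ => Iff.rfl
theorem Equiv.symm (h : Equiv F x y) : Equiv F y x := fun e he => (h e he).symm
theorem Equiv.trans (h : Equiv F x y) (h' : Equiv F y z) : Equiv F x z :=
  fun e he => (h e he).trans (h' e he)
theorem Equiv.mono (h : F ⊆ G) (h' : Equiv G x y) : Equiv F x y := fun e he => h' e (h he)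

theorem equiv_union : Equiv (F ∪ G) x y ↔ Equiv F x y ∧ Equiv G x y := by
  simp only [Equiv, Finset.mem_union, or_imp, forall_and]

theorem equiv_insert : Equiv (insert e F) x y ↔ (x ∈ e ↔ y ∈ e) ∧ Equiv F x y := by
  simp only [Equiv, Finset.mem_insert, or_imp, forall_and, forall_eq]

theorem filter_mem_eq_iff : F.filter (x ∈ ·) = F.filter (y ∈ ·) ↔ Equiv F x y := by
  exact Finset.filter_inj'.trans Iff.rfl

theorem separates_iff (h : x ≠ y) : Separates e x y ↔ ¬(x ∈ e ↔ y ∈ e) := by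
  unfold Separates
  by_cases hx : x ∈ e <;> by_cases hy : y ∈ e <;>
    simp [Finset.insert_inter_of_mem, Finset.insert_inter_of_notMem, hx, hy, h]

theorem isTestCover_iff : IsTestCover V T ↔ ∀ x ∈ V, ∀ y ∈ V, Equiv T x y → x = y := by
  refine forall₄_congr fun x _ y _ => ?_
  constructor
  · intro h he
    by_contra hxy
    obtain ⟨e, heT, hs⟩ := h hxy
    exact (separates_iff hxy).1 hs (he e heT)
  · intro h hxy
    by_contra hn
    push Not at hn
    exact hxy (h fun e he => by_contra fun h' => hn e he ((separates_iff hxy).2 h'))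

theorem exists_transversal (V : Finset ℕ) (F : Finset (Finset ℕ)) :
    ∃ S ⊆ V, S.card = cls V F ∧ (∀ x ∈ S, ∀ y ∈ S, Equiv F x y → x = y) ∧
      ∀ v ∈ V, ∃ s ∈ S, Equiv F v s := by
  obtain ⟨S, hS, hinj, him⟩ := Finset.exists_subset_injOn_image_eq_of_surjOn
    (f := fun v => F.filter (v ∈ ·)) (s := (V : Set ℕ)) (V.image fun v => F.filter (v ∈ ·))
    (by rw [Finset.coe_image]; exact Set.surjOn_image _ _)
  refine ⟨S, by exact_mod_cast hS, ?_, fun x hx y hy h => hinj hx hy (filter_mem_eq_iff.2 h),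
    fun v hv => ?_⟩
  · rw [cls, ← him, Finset.card_image_of_injOn hinj]
  · have : F.filter (v ∈ ·) ∈ S.image fun v => F.filter (v ∈ ·) := by
      rw [him]; exact Finset.mem_image_of_mem (fun v => F.filter (v ∈ ·)) hv
    obtain ⟨s, hs, h⟩ := Finset.mem_image.1 this
    exact ⟨s, hs, filter_mem_eq_iff.1 h.symm⟩

theorem card_le_cls (hS : S ⊆ V) (h : ∀ x ∈ S, ∀ y ∈ S, Equiv F x y → x = y) :
    S.card ≤ cls V F := by
  rw [cls, ← Finset.card_image_of_injOn (s := S) (f := fun v => F.filter (v ∈ ·))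
    fun x hx y hy hxy => h x hx y hy (filter_mem_eq_iff.1 hxy)]
  exact Finset.card_le_card (Finset.image_subset_image hS)

theorem cls_le_card : cls V F ≤ V.card := Finset.card_image_le

/-- A transversal for `F` on `A` stays pairwise inequivalent under `G`. This covers monotonicity
both in the vertices and in the edges. -/
theorem cls_le_cls (hA : A ⊆ V) (h : ∀ x ∈ A, ∀ y ∈ A, Equiv G x y → Equiv F x y) :
    cls A F ≤ cls V G := by
  obtain ⟨S, hS, hc, hi, -⟩ := exists_transversal A F
  rw [← hc]
  exact card_le_cls (hS.trans hA) fun x hx y hy hxy => hi x hx y hy (h x (hS hx) y (hS hy) hxy)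

theorem cls_union_le : cls (V ∪ A) F ≤ cls V F + cls A F := by
  rw [cls, Finset.image_union]; exact Finset.card_union_le _ _

theorem cls_eq_card_iff : cls V T = V.card ↔ IsTestCover V T := by
  rw [isTestCover_iff]
  refine ⟨fun h x hx y hy hxy => Finset.card_image_iff.1 h hx hy (filter_mem_eq_iff.2 hxy),
    fun h => le_antisymm cls_le_card (card_le_cls subset_rfl h)⟩

theorem cls_le_one (h : ∀ x ∈ V, ∀ y ∈ V, Equiv F x y) : cls V F ≤ 1 :=
  Finset.card_le_one.2 fun a ha b hb => by
    obtain ⟨x, hx, rfl⟩ := Finset.mem_image.1 ha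
    obtain ⟨y, hy, rfl⟩ := Finset.mem_image.1 hb
    exact filter_mem_eq_iff.2 (h x hx y hy)

theorem cls_pos (h : V.Nonempty) : 1 ≤ cls V F := Finset.card_pos.2 (h.image _)

/-- In a transversal for `F`, the representative of the common class of `a` and `b` is replaced by
both of them. -/
theorem cls_add_one_le (h : F ⊆ G) (ha : a ∈ V) (hb : b ∈ V) (hab : Equiv F a b)
    (hab' : ¬Equiv G a b) : cls V F + 1 ≤ cls V G := by
  classical
  obtain ⟨S, hS, hc, hi, hs⟩ := exists_transversal V F
  obtain ⟨s, hsS, hsa⟩ := hs a ha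
  have h1 : insert a (insert b (S.erase s)) ⊆ V := by
    intro v hv
    simp only [Finset.mem_insert, Finset.mem_erase] at hv
    rcases hv with rfl | rfl | hv
    exacts [ha, hb, hS hv.2]
  have h2 : ∀ v ∈ S.erase s, ¬Equiv F a v := fun v hv hav =>
    (Finset.mem_erase.1 hv).1 (hi v (Finset.mem_erase.1 hv).2 s hsS (hav.symm.trans hsa))
  have h3 : a ∉ insert b (S.erase s) := by
    rw [Finset.mem_insert, not_or]
    exact ⟨fun h => hab' (h ▸ Equiv.refl G a), fun h => h2 a h (Equiv.refl F a)⟩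
  have h4 : b ∉ S.erase s := fun h => h2 b h hab
  have h5 := card_le_cls (F := G) h1 fun x hx y hy hxy => by
    have hxy' := hxy.mono h
    simp only [Finset.mem_insert] at hx hy
    rcases hx with rfl | rfl | hx <;> rcases hy with rfl | rfl | hy
    · rfl
    · exact absurd hxy hab'
    · exact absurd hxy' (h2 _ hy)
    · exact absurd hxy.symm hab'
    · rfl
    · exact absurd (hab.trans hxy') (h2 _ hy)
    · exact absurd hxy'.symm (h2 _ hx)
    · exact absurd (hab.trans hxy'.symm) (h2 _ hx)
    · exact hi x (Finset.mem_erase.1 hx).2 y (Finset.mem_erase.1 hy).2 hxy'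
  have h6 := Finset.card_erase_add_one hsS
  rw [Finset.card_insert_of_notMem h3, Finset.card_insert_of_notMem h4] at h5
  omega

/-- Two different classes are cut. Setting the class of `a` aside loses one class of `F`; the other
vertices gain a class from `c` and `d`, and then `a` and `b` are put back as two classes. -/
theorem cls_add_two_le (h : F ⊆ G) (ha : a ∈ V) (hb : b ∈ V) (hc : c ∈ V) (hd : d ∈ V)
    (hab : Equiv F a b) (hab' : ¬Equiv G a b) (hcd : Equiv F c d) (hcd' : ¬Equiv G c d)
    (hac : ¬Equiv F a c) : cls V F + 2 ≤ cls V G := by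
  classical
  have key : cls V F ≤ cls (V.filter (Equiv F a)) F + cls (V.filter fun v => ¬Equiv F a v) F := by
    conv_lhs => rw [← Finset.filter_union_filter_not_eq (Equiv F a) V]
    exact cls_union_le
  have h1 : cls (V.filter (Equiv F a)) F ≤ 1 := cls_le_one fun x hx y hy =>
    (Finset.mem_filter.1 hx).2.symm.trans (Finset.mem_filter.1 hy).2
  have h2 : cls (V.filter fun v => ¬Equiv F a v) F + 1 ≤
      cls (V.filter fun v => ¬Equiv F a v) G :=
    cls_add_one_le h (Finset.mem_filter.2 ⟨hc, hac⟩)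
      (Finset.mem_filter.2 ⟨hd, fun h => hac (h.trans hcd.symm)⟩) hcd hcd'
  obtain ⟨S, hS, hcS, hi, -⟩ := exists_transversal (V.filter fun v => ¬Equiv F a v) G
  have h0 : ∀ v ∈ S, v ∈ V ∧ ¬Equiv F a v := fun v hv => Finset.mem_filter.1 (hS hv)
  have h3 : a ∉ insert b S := by
    rw [Finset.mem_insert, not_or]
    exact ⟨fun h => hab' (h ▸ Equiv.refl G a), fun h => (h0 a h).2 (Equiv.refl F a)⟩
  have h4 : b ∉ S := fun h => (h0 b h).2 hab
  have h5 := card_le_cls (V := V) (S := insert a (insert b S)) (F := G)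
    (by
      intro v hv
      simp only [Finset.mem_insert] at hv
      rcases hv with rfl | rfl | hv
      exacts [ha, hb, (h0 v hv).1]) fun x hx y hy hxy => by
    have hxy' := hxy.mono h
    simp only [Finset.mem_insert] at hx hy
    rcases hx with rfl | rfl | hx <;> rcases hy with rfl | rfl | hy
    · rfl
    · exact absurd hxy hab'
    · exact absurd hxy' (h0 _ hy).2
    · exact absurd hxy.symm hab'
    · rfl
    · exact absurd (hab.trans hxy') (h0 _ hy).2
    · exact absurd hxy'.symm (h0 _ hx).2
    · exact absurd (hab.trans hxy'.symm) (h0 _ hx).2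
    · exact hi x hx y hy hxy
  rw [Finset.card_insert_of_notMem h3, Finset.card_insert_of_notMem h4] at h5
  omega

/-- From `B` one can select edges, each of which adds a class, with the effect of all of `B`. -/
theorem exists_independent_subset (V : Finset ℕ) (A B : Finset (Finset ℕ)) :
    ∃ B' ⊆ B, (∀ x ∈ V, ∀ y ∈ V, Equiv (A ∪ B') x y → Equiv (A ∪ B) x y) ∧
      B'.card + cls V A ≤ cls V (A ∪ B') := by
  induction B using Finset.induction_on with
  | empty => exact ⟨∅, subset_rfl, fun x _ y _ h => h, by simp⟩
  | insert e B _ ih =>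
    obtain ⟨B', hB, h1, h2⟩ := ih
    -- An edge that cuts no class of `A ∪ B'` is redundant; any other is kept and pays for itself
    -- with a new class.
    by_cases he : ∀ x ∈ V, ∀ y ∈ V, Equiv (A ∪ B') x y → (x ∈ e ↔ y ∈ e)
    · refine ⟨B', hB.trans (Finset.subset_insert _ _), fun x hx y hy h => ?_, h2⟩
      rw [Finset.union_insert, equiv_insert]
      exact ⟨he x hx y hy h, h1 x hx y hy h⟩
    · push Not at he
      obtain ⟨x, hx, y, hy, hxy, hne⟩ := he
      refine ⟨insert e B', Finset.insert_subset_insert e hB, fun x hx y hy h => ?_, ?_⟩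
      · rw [Finset.union_insert, equiv_insert] at h ⊢
        exact ⟨h.1, h1 x hx y hy h.2⟩
      · have := cls_add_one_le (G := A ∪ insert e B') (by rw [Finset.union_insert]; simp) hx hy hxy
          (by rw [Finset.union_insert, equiv_insert]; rintro ⟨h, -⟩; tauto)
        have := Finset.card_insert_le e B'
        omega

theorem iff_of_not_iff {p q r : Prop} (h : ¬(p ↔ r)) (h' : ¬(q ↔ r)) : p ↔ q := by tauto

/-- A family of edges, each of which cuts at most one class of `F`, and no two of which cut
a class of `F` into four, adds at most as many classes as it has edges. -/
theorem cls_union_le_of_compatible (V : Finset ℕ) (F : Finset (Finset ℕ)) (D : Finset (Finset ℕ))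
    (h1 : ∀ e ∈ D, ∀ a ∈ V, ∀ b ∈ V, ∀ c ∈ V, ∀ d ∈ V, Equiv F a b → Equiv F c d →
      a ∈ e → b ∉ e → c ∈ e → d ∉ e → Equiv F a c)
    (h2 : ∀ e ∈ D, ∀ e' ∈ D, ∀ a ∈ V, ∀ b ∈ V, ∀ c ∈ V, ∀ d ∈ V, Equiv F a b → Equiv F a c →
      Equiv F a d → a ∈ e → a ∈ e' → b ∈ e → b ∉ e' → c ∉ e → c ∈ e' → d ∉ e → d ∉ e' → False) :
    cls V (D ∪ F) ≤ cls V F + D.card := by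
  classical
  induction hn : D.card generalizing D with
  | zero => rw [Finset.card_eq_zero.1 hn]; simp
  | succ n ih =>
  by_cases hcut : ∀ e ∈ D, ∀ x ∈ V, ∀ y ∈ V, Equiv F x y → (x ∈ e ↔ y ∈ e)
  · refine (cls_le_cls subset_rfl fun x hx y hy h => ?_).trans (Nat.le_add_right _ _)
    exact equiv_union.2 ⟨fun e he => hcut e he x hx y hy h, h⟩
  simp only [not_forall] at hcut
  obtain ⟨e₀, he₀, x₀, hx₀, o, ho, hxo, hne⟩ := hcut
  -- `tr e` is the side, away from `o`, of the cut that `e` makes in the class of `o`. The edge `e₁`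
  -- with the smallest nonempty side is peeled off.
  let tr : Finset ℕ → Finset ℕ := fun e => V.filter fun x => Equiv F o x ∧ ¬(x ∈ e ↔ o ∈ e)
  have htr : ∀ {e x}, x ∈ tr e ↔ x ∈ V ∧ Equiv F o x ∧ ¬(x ∈ e ↔ o ∈ e) := Finset.mem_filter
  obtain ⟨e₁, he₁, hmin⟩ := (D.filter fun e => (tr e).Nonempty).exists_min_image
    (fun e => (tr e).card) ⟨e₀, Finset.mem_filter.2 ⟨he₀, x₀, htr.2 ⟨hx₀, hxo.symm, hne⟩⟩⟩
  obtain ⟨he₁, w, hw⟩ := Finset.mem_filter.1 he₁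
  -- The forbidden configuration, stated without fixing which of the two pairs lies in `e`.
  have four : ∀ e ∈ D, ∀ e' ∈ D, ∀ p ∈ V, Equiv F o p → ∀ q ∈ V, Equiv F o q → ∀ s ∈ V,
      Equiv F o s → ∀ t ∈ V, Equiv F o t → (p ∈ e ↔ q ∈ e) → (s ∈ e ↔ t ∈ e) →
      ¬(p ∈ e ↔ s ∈ e) → p ∈ e' → q ∉ e' → s ∈ e' → t ∉ e' → False := by
    intro e he e' he' p hp hop q hq hoq s hs hos t ht hot hpq hst hps h1 h3 h4 h5
    by_cases hpe : p ∈ e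
    · have hse : s ∉ e := fun h => hps (iff_of_true hpe h)
      exact h2 e he e' he' p hp q hq s hs t ht (hop.symm.trans hoq) (hop.symm.trans hos)
        (hop.symm.trans hot) hpe h1 (hpq.1 hpe) h3 hse h4 (fun h => hse (hst.2 h)) h5
    · have hse : s ∈ e := by_contra fun h => hps (iff_of_false hpe h)
      exact h2 e he e' he' s hs t ht p hp q hq (hos.symm.trans hot) (hos.symm.trans hop)
        (hos.symm.trans hoq) hse h4 (hst.1 hse) h5 hpe h1 (fun h => hpe (hpq.2 h)) h3
  have hdiff : ∀ e' ∈ D, ∀ z ∈ tr e', ∀ v ∈ tr e₁, v ∉ tr e' → ∃ v ∈ tr e', v ∉ tr e₁ := by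
    intro e' he' z hz v hv hv'
    by_contra hcon
    push Not at hcon
    have hlt := Finset.card_lt_card
      (Finset.ssubset_iff_subset_ne.2 ⟨fun a ha => hcon a ha, fun h => hv' (h ▸ hv)⟩ :
        tr e' ⊂ tr e₁)
    have := hmin e' (Finset.mem_filter.2 ⟨he', z, hz⟩)
    omega
  -- If `e'` split `tr e₁`, minimality would give `v` in `tr e'` outside `tr e₁`, and `x`, `y`, `o`,
  -- `v` would lie in the four different quadrants of `e₁` and `e'`.
  have hconst : ∀ e' ∈ D, e' ≠ e₁ → ∀ x ∈ tr e₁, ∀ y ∈ tr e₁, x ∈ e' → y ∈ e' := by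
    intro e' he' hne x hx y hy hxe
    by_contra hye
    have hx' := htr.1 hx
    have hy' := htr.1 hy
    have hv : ∃ v ∈ tr e', v ∉ tr e₁ := by
      by_cases hoe : o ∈ e'
      · exact hdiff e' he' y (htr.2 ⟨hy'.1, hy'.2.1, fun h => hye (h.2 hoe)⟩) x hx
          fun h => (htr.1 h).2.2 (iff_of_true hxe hoe)
      · exact hdiff e' he' x (htr.2 ⟨hx'.1, hx'.2.1, fun h => hoe (h.1 hxe)⟩) y hy
          fun h => (htr.1 h).2.2 (iff_of_false hye hoe)
    obtain ⟨v, hv, hv1⟩ := hv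
    have hv' := htr.1 hv
    have hv1' : v ∈ e₁ ↔ o ∈ e₁ := by
      by_contra h; exact hv1 (htr.2 ⟨hv'.1, hv'.2.1, h⟩)
    have hxy := iff_of_not_iff hx'.2.2 hy'.2.2
    by_cases hoe : o ∈ e'
    · have hve : v ∉ e' := fun h => hv'.2.2 (iff_of_true h hoe)
      exact four e₁ he₁ e' he' x hx'.1 hx'.2.1 y hy'.1 hy'.2.1 o ho (.refl F o) v hv'.1 hv'.2.1
        hxy hv1'.symm hx'.2.2 hxe hye hoe hve
    · have hve : v ∈ e' := by_contra fun h => hv'.2.2 (iff_of_false h hoe)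
      exact four e₁ he₁ e' he' x hx'.1 hx'.2.1 y hy'.1 hy'.2.1 v hv'.1 hv'.2.1 o ho (.refl F o)
        hxy hv1' (fun h => hx'.2.2 (h.trans hv1')) hxe hye hve hoe
  have hmem : ∀ {x}, x ∈ V \ tr e₁ → x ∈ V ∧ (Equiv F o x → (x ∈ e₁ ↔ o ∈ e₁)) := by
    intro x hx
    rw [Finset.mem_sdiff, htr] at hx
    exact ⟨hx.1, fun h => by_contra fun h' => hx.2 ⟨hx.1, h, h'⟩⟩
  -- `tr e₁` is a single class, and on its complement `e₁` cuts no class of `F`, because the class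
  -- of `o` is the only one it cuts.
  have hstep : cls V (D ∪ F) ≤ cls V (D.erase e₁ ∪ F) + 1 := by
    have hV : V = (V \ tr e₁) ∪ tr e₁ := (Finset.sdiff_union_of_subset (Finset.filter_subset _ _)).symm
    conv_lhs => rw [hV]
    refine cls_union_le.trans (add_le_add (cls_le_cls Finset.sdiff_subset fun x hx y hy h => ?_)
      (cls_le_one fun x hx y hy => ?_))
    · rw [equiv_union] at h ⊢
      refine ⟨fun e he => ?_, h.2⟩
      rcases eq_or_ne e e₁ with rfl | hee
      · have hx := hmem hx
        have hy := hmem hy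
        by_cases hox : Equiv F o x
        · rw [hx.2 hox, hy.2 (hox.trans h.2)]
        · have hw' := htr.1 hw
          by_contra hne
          have key : ∀ a ∈ V, ∀ b ∈ V, Equiv F o a → Equiv F o b → a ∈ e → b ∉ e →
              Equiv F o x := by
            intro a ha b hb hoa hob hae hbe
            by_cases hxe : x ∈ e
            · exact hoa.trans (h1 e he₁ a ha b hb x hx.1 y hy.1 (hoa.symm.trans hob) h.2 hae hbe
                hxe fun hye => hne (iff_of_true hxe hye))
            · exact hoa.trans ((h1 e he₁ a ha b hb y hy.1 x hx.1 (hoa.symm.trans hob) h.2.symm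
                hae hbe (by_contra fun hye => hne (iff_of_false hxe hye)) hxe).trans h.2.symm)
          by_cases hoe : o ∈ e
          · exact hox (key o ho w hw'.1 (.refl F o) hw'.2.1 hoe
              fun h => hw'.2.2 (iff_of_true h hoe))
          · exact hox (key w hw'.1 o ho hw'.2.1 (.refl F o)
              (by_contra fun h => hw'.2.2 (iff_of_false h hoe)) hoe)
      · exact h.1 e (Finset.mem_erase.2 ⟨hee, he⟩)
    · rw [equiv_union]
      refine ⟨fun e he => ?_, (htr.1 hx).2.1.symm.trans (htr.1 hy).2.1⟩
      rcases eq_or_ne e e₁ with rfl | hee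
      · exact iff_of_not_iff (htr.1 hx).2.2 (htr.1 hy).2.2
      · exact ⟨hconst e he hee x hx y hy, hconst e he hee y hy x hx⟩
  have hcard := Finset.card_erase_of_mem he₁
  have := ih (D.erase e₁)
    (fun e he => h1 e (Finset.mem_of_mem_erase he))
    (fun e he e' he' => h2 e (Finset.mem_of_mem_erase he) e' (Finset.mem_of_mem_erase he'))
    (by omega)
  omega

/-- If some set of edges has `k` classes more than edges, then so has one with at most
`2 * (k - 1)` edges. -/
theorem exists_small_subset {k : ℕ} (hk : 1 ≤ k) (hT : T.card + k ≤ cls V T) :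
    ∃ F ⊆ T, F.card + 2 ≤ 2 * k ∧ F.card + k ≤ cls V F := by
  -- Induction on the excess `j` of classes over edges: the empty set has excess 1, and each further
  -- unit costs at most two edges.
  have key : ∀ j, 1 ≤ j → j ≤ k → ∃ F ⊆ T, F.card + 2 ≤ 2 * j ∧ F.card + j ≤ cls V F := by
    intro j hj
    induction j, hj using Nat.le_induction with
    | base =>
      intro _
      refine ⟨∅, Finset.empty_subset _, by simp, ?_⟩
      have : V.Nonempty := by
        rw [Finset.nonempty_iff_ne_empty]; rintro rfl
        simp [cls] at hT; omega
      simpa using cls_pos this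
    | succ j hj ih =>
      intro hjk
      obtain ⟨F, hF, hc, hF'⟩ := ih (by omega)
      by_contra hcon
      push Not at hcon
      have hlt := hcon F hF (by omega)
      -- If the excess cannot be raised, all remaining edges of `T` are compatible, so `T` itself
      -- would have excess at most `j < k`.
      have hD := cls_union_le_of_compatible V F (T \ F)
        (fun e he a ha b hb c hc' d hd hab hcd hae hbe hce hde => by
          by_contra hac
          have h1 := cls_add_two_le (Finset.subset_insert e F) ha hb hc' hd hab
            (by rw [equiv_insert]; tauto) hcd (by rw [equiv_insert]; tauto) hac
          have h2 := Finset.card_insert_le e F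
          have := hcon (insert e F) (Finset.insert_subset (Finset.mem_sdiff.1 he).1 hF) (by omega)
          omega)
        (fun e he e' he' a ha b hb c hc' d hd hab hac had h1 h2 h3 h4 h5 h6 h7 h8 => by
          have g1 := cls_add_one_le (Finset.subset_insert e F) ha hc' hac
            (by rw [equiv_insert]; tauto)
          have g2 := cls_add_two_le (Finset.subset_insert e' (insert e F)) ha hb hc' hd
            (by rw [equiv_insert]; tauto) (by rw [equiv_insert]; tauto)
            (by rw [equiv_insert]; exact ⟨by tauto, hac.symm.trans had⟩)
            (by rw [equiv_insert]; tauto) (by rw [equiv_insert]; tauto)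
          have c1 := Finset.card_insert_le e F
          have c2 := Finset.card_insert_le e' (insert e F)
          have := hcon (insert e' (insert e F)) (Finset.insert_subset (Finset.mem_sdiff.1 he').1
            (Finset.insert_subset (Finset.mem_sdiff.1 he).1 hF)) (by omega)
          omega)
      rw [Finset.sdiff_union_of_subset hF] at hD
      have := Finset.card_sdiff_add_card_eq_card hF
      omega
  exact key k hk le_rfl

/-- A test cover has `V.card` classes. Conversely, `F` is completed by edges that each add a class,
at most `V.card - cls V F` of them, which preserves the surplus `k`. -/
theorem exists_isTestCover_iff {k : ℕ} (hE : IsTestCover V E) :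
    (∃ T ⊆ E, IsTestCover V T ∧ (T.card : ℤ) ≤ (V.card : ℤ) - (k : ℤ)) ↔
      ∃ F ⊆ E, F.card + k ≤ cls V F := by
  constructor
  · rintro ⟨T, hT, hc, hle⟩
    refine ⟨T, hT, ?_⟩
    rw [cls_eq_card_iff.2 hc]; omega
  · rintro ⟨F, hF, hle⟩
    obtain ⟨B, hB, h1, h2⟩ := exists_independent_subset V F E
    have hc : IsTestCover V (F ∪ B) := isTestCover_iff.2 fun x hx y hy hxy =>
      isTestCover_iff.1 hE x hx y hy (Equiv.mono Finset.subset_union_right (h1 x hx y hy hxy))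
    refine ⟨F ∪ B, Finset.union_subset hF hB, hc, ?_⟩
    have := Finset.card_union_le F B
    rw [cls_eq_card_iff.2 hc] at h2
    omega

end Classes

/-! ### Removal of a component -/

theorem not_equiv_insert {F : Finset (Finset ℕ)} {e : Finset ℕ} {a b : ℕ} (ha : a ∈ e)
    (hb : b ∉ e) : ¬Equiv (insert e F) a b :=
  fun h => hb ((h e (Finset.mem_insert_self e F)).1 ha)

theorem not_equiv_insert' {F : Finset (Finset ℕ)} {e : Finset ℕ} {a b : ℕ} (ha : a ∉ e)
    (hb : b ∈ e) : ¬Equiv (insert e F) a b :=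
  fun h => ha ((h e (Finset.mem_insert_self e F)).2 hb)

/-- Some edge contains both `x` and `y`. -/
def Adj (E : Finset (Finset ℕ)) (x y : ℕ) : Prop := ∃ e ∈ E, x ∈ e ∧ y ∈ e

/-- The vertices in no edge of `F`. -/
def rest (V : Finset ℕ) (F : Finset (Finset ℕ)) : Finset ℕ := V.filter fun v => ∀ e ∈ F, v ∉ e

/-- The edge `e` separates `u` and `v` when only vertices covered by `F` are considered. -/
def SepOn (F : Finset (Finset ℕ)) (e : Finset ℕ) (u v : ℕ) : Prop :=
  ¬((u ∈ e ∧ ∃ f ∈ F, u ∈ f) ↔ (v ∈ e ∧ ∃ f ∈ F, v ∈ f))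

open Classical in
/-- The vertices of `rest V F` whose component meets an edge that separates `u` and `v`. -/
noncomputable def sepComps (V : Finset ℕ) (E F : Finset (Finset ℕ)) (u v : ℕ) : Finset ℕ :=
  (rest V F).filter fun x => ∃ e ∈ E, SepOn F e u v ∧ ∃ y ∈ rest V F, y ∈ e ∧ Adj E x y

open Classical in
/-- The component of `x` in `rest V F`. -/
noncomputable def component (V : Finset ℕ) (E F : Finset (Finset ℕ)) (x : ℕ) : Finset ℕ :=
  (rest V F).filter (Adj E x)

theorem Adj.symm {E : Finset (Finset ℕ)} {x y : ℕ} : Adj E x y → Adj E y x :=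
  fun ⟨e, he, hx, hy⟩ => ⟨e, he, hy, hx⟩

theorem mem_rest {V : Finset ℕ} {F : Finset (Finset ℕ)} {x : ℕ} :
    x ∈ rest V F ↔ x ∈ V ∧ ∀ e ∈ F, x ∉ e := Finset.mem_filter

open Classical in
theorem mem_component {V : Finset ℕ} {E F : Finset (Finset ℕ)} {x y : ℕ} :
    y ∈ component V E F x ↔ y ∈ rest V F ∧ Adj E x y := Finset.mem_filter

open Classical in
theorem mem_sepComps {V : Finset ℕ} {E F : Finset (Finset ℕ)} {u v x : ℕ} :
    x ∈ sepComps V E F u v ↔ x ∈ rest V F ∧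
      ∃ e ∈ E, SepOn F e u v ∧ ∃ y ∈ rest V F, y ∈ e ∧ Adj E x y := Finset.mem_filter

theorem exists_uncovered {A : Finset ℕ} {T : Finset (Finset ℕ)} {r : ℕ}
    (hr : ∀ e ∈ T, e.card ≤ r) (h : T.card * r < A.card) : ∃ o ∈ A, ∀ e ∈ T, o ∉ e := by
  by_contra hcon
  push Not at hcon
  have h1 : A ⊆ T.biUnion fun e => e := fun a ha => Finset.mem_biUnion.2 (hcon a ha)
  have := (Finset.card_le_card h1).trans (Finset.card_biUnion_le_card_mul T _ r hr)
  omega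

/-- A hypergraph `(V, E)` with edges of size at most `r` and a set `F` of edges such that adding
one or two edges adds at most as many classes, and sufficiently many vertices are uncovered. -/
structure LocallyMaximal (V : Finset ℕ) (E F : Finset (Finset ℕ)) (k r : ℕ) : Prop where
  edge_subset : ∀ e ∈ E, e ⊆ V
  edge_card_le : ∀ e ∈ E, e.card ≤ r
  isTestCover : IsTestCover V E
  subset : F ⊆ E
  cls_insert_le : ∀ e ∈ E, cls V (insert e F) ≤ cls V F + 1
  cls_insert_insert_le : ∀ e ∈ E, ∀ e' ∈ E, cls V (insert e (insert e' F)) ≤ cls V F + 2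
  le_card_rest : 4 * k * r ≤ (rest V F).card
  one_le_k : 1 ≤ k
  one_le_r : 1 ≤ r

/-! ### Components of the uncovered vertices and the exchange argument. -/

namespace LocallyMaximal

variable {V : Finset ℕ} {E F P : Finset (Finset ℕ)} {k r : ℕ} (hM : LocallyMaximal V E F k r)
  {e e' : Finset ℕ} {u v w x y z a b c : ℕ}

theorem equiv_rest (ha : a ∈ rest V F) (hb : b ∈ rest V F) : Equiv F a b :=
  fun e he => iff_of_false ((mem_rest.1 ha).2 e he) ((mem_rest.1 hb).2 e he)

theorem mem_rest_of_equiv (ha : a ∈ rest V F) (hb : b ∈ V) (h : Equiv F a b) : b ∈ rest V F :=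
  mem_rest.2 ⟨hb, fun e he hbe => (mem_rest.1 ha).2 e he ((h e he).2 hbe)⟩

include hM

theorem exists_rest_notMem (hP : P ⊆ E) (hc : P.card < 4 * k) :
    ∃ o ∈ rest V F, ∀ e ∈ P, o ∉ e :=
  exists_uncovered (fun e he => hM.edge_card_le e (hP he))
    ((Nat.mul_lt_mul_of_pos_right hc hM.one_le_r).trans_le hM.le_card_rest)

/-- An edge that meets `rest V F` separates no equivalent vertices outside of it. -/
theorem mem_rest_of_cut (he : e ∈ E) (hw : w ∈ rest V F) (hwe : w ∈ e) (hy : y ∈ V) (hz : z ∈ V)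
    (hyz : Equiv F y z) (hye : y ∈ e) (hze : z ∉ e) : y ∈ rest V F ∧ z ∈ rest V F := by
  have hk := hM.one_le_k
  -- The vertex `o` shows that `e` cuts the class `rest V F`; cutting a second class would gain two
  -- classes with one edge.
  obtain ⟨o, ho, hoe⟩ := hM.exists_rest_notMem (P := {e}) (by simpa using he) (by simp; omega)
  have hoe := hoe e (Finset.mem_singleton_self e)
  have hwy : Equiv F w y := by
    by_contra hne
    have := cls_add_two_le (Finset.subset_insert e F) (mem_rest.1 hw).1 (mem_rest.1 ho).1 hy hz
      (equiv_rest hw ho) (by rw [equiv_insert]; tauto) hyz (by rw [equiv_insert]; tauto) hne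
    have := hM.cls_insert_le e he
    omega
  have hy' := mem_rest_of_equiv hw hy hwy
  exact ⟨hy', mem_rest_of_equiv hy' hz hyz⟩

/-- The traces of the edges on `rest V F` are nested or disjoint. -/
theorem laminar (he : e ∈ E) (he' : e' ∈ E) (ha : a ∈ rest V F) (hb : b ∈ rest V F)
    (hc : c ∈ rest V F) (hae : a ∈ e) (hae' : a ∈ e') (hbe : b ∈ e) (hbe' : b ∉ e')
    (hce : c ∉ e) (hce' : c ∈ e') : False := by
  have hk := hM.one_le_k
  -- With `o` outside both edges, crossing traces cut `rest V F` into four, a gain of three classes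
  -- with two edges.
  obtain ⟨o, ho, hoe⟩ := hM.exists_rest_notMem (P := {e, e'})
    (by rw [Finset.insert_subset_iff, Finset.singleton_subset_iff]; exact ⟨he, he'⟩)
    ((Finset.card_insert_le _ _).trans_lt (by simp; omega))
  have ho1 := hoe e (by simp)
  have ho2 := hoe e' (by simp)
  have hV : ∀ {x}, x ∈ rest V F → x ∈ V := fun h => (mem_rest.1 h).1
  have g1 := cls_add_one_le (Finset.subset_insert e F) (hV ha) (hV hc) (equiv_rest ha hc)
    (by rw [equiv_insert]; tauto)
  have g2 := cls_add_two_le (Finset.subset_insert e' (insert e F)) (hV ha) (hV hb) (hV hc) (hV ho)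
    (by rw [equiv_insert]; exact ⟨by tauto, equiv_rest ha hb⟩) (by rw [equiv_insert]; tauto)
    (by rw [equiv_insert]; exact ⟨by tauto, equiv_rest hc ho⟩) (by rw [equiv_insert]; tauto)
    (by rw [equiv_insert]; tauto)
  have := hM.cls_insert_insert_le e' he' e he
  omega

/-- Otherwise the two edges cross, with `y` in common and `x`, `z` each in one only, against
laminarity. This is why one adjacency suffices to define a component. -/
theorem adj_trans (hx : x ∈ rest V F) (hy : y ∈ rest V F) (hz : z ∈ rest V F) (h : Adj E x y)
    (h' : Adj E y z) : Adj E x z := by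
  obtain ⟨e, he, hxe, hye⟩ := h
  obtain ⟨e', he', hye', hze'⟩ := h'
  by_contra hn
  exact hM.laminar he he' hy hx hz hye hye' hxe (fun h => hn ⟨e', he', h, hze'⟩)
    (fun h => hn ⟨e, he, hxe, h⟩) hze'

/-- The component met by an edge has at most `r` vertices. -/
theorem card_touched_le (he : e ∈ E) [DecidablePred fun x => ∃ y ∈ rest V F, y ∈ e ∧ Adj E x y] :
    ((rest V F).filter fun x => ∃ y ∈ rest V F, y ∈ e ∧ Adj E x y).card ≤ r := by
  by_cases hne : ∃ w ∈ rest V F, w ∈ e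
  · obtain ⟨w, hw, hwe⟩ := hne
    -- A largest trace among those meeting `e`. By laminarity it contains every trace that meets
    -- both it and `e`, hence all the vertices counted.
    obtain ⟨e₁, he₁, hmax⟩ := (E.filter fun e' => (rest V F ∩ e ∩ e').Nonempty).exists_max_image
      (fun e' => (rest V F ∩ e').card) ⟨e, Finset.mem_filter.2 ⟨he, w, by simp [hw, hwe]⟩⟩
    obtain ⟨he₁, w₁, hw₁⟩ := Finset.mem_filter.1 he₁
    simp only [Finset.mem_inter] at hw₁
    have hsub : ∀ e' ∈ E, (∃ v ∈ rest V F, v ∈ e' ∧ v ∈ e) → (∃ v ∈ rest V F, v ∈ e' ∧ v ∈ e₁) →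
        ∀ x ∈ rest V F, x ∈ e' → x ∈ e₁ := by
      rintro e' he' ⟨t, ht, hte', hte⟩ ⟨v, hv, hve', hve₁⟩ x hx hxe'
      by_contra hxe₁
      have hss : rest V F ∩ e₁ ⊂ rest V F ∩ e' := by
        refine (Finset.ssubset_iff_of_subset fun c hc => ?_).2
          ⟨x, Finset.mem_inter.2 ⟨hx, hxe'⟩, fun h => hxe₁ (Finset.mem_inter.1 h).2⟩
        have hc := Finset.mem_inter.1 hc
        refine Finset.mem_inter.2 ⟨hc.1, by_contra fun hce' => ?_⟩
        exact hM.laminar he' he₁ hv hx hc.1 hve' hve₁ hxe' hxe₁ hce' hc.2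
      have := Finset.card_lt_card hss
      have := hmax e' (Finset.mem_filter.2 ⟨he', t, by simp [ht, hte, hte']⟩)
      omega
    refine (Finset.card_le_card fun x hx => ?_).trans (hM.edge_card_le e₁ he₁)
    obtain ⟨hx, y, hy, hye, e₂, he₂, hxe₂, hye₂⟩ := Finset.mem_filter.1 hx
    have hye₁ := hsub e he ⟨w, hw, hwe, hwe⟩ ⟨w₁, hw₁.1.1, hw₁.1.2, hw₁.2⟩ y hy hye
    exact hsub e₂ he₂ ⟨y, hy, hye₂, hye⟩ ⟨y, hy, hye₂, hye₁⟩ x hx hxe₂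
  · push Not at hne
    rw [Finset.filter_false_of_mem]
    · simp
    · rintro x - ⟨y, hy, hye, -⟩
      exact hne y hy hye

theorem mem_component_of_meets (hx : x ∈ rest V F) (he : e ∈ E) (hw : w ∈ component V E F x)
    (hwe : w ∈ e) (hy : y ∈ rest V F) (hye : y ∈ e) : y ∈ component V E F x := by
  rw [mem_component] at hw ⊢
  exact ⟨hy, hM.adj_trans hx hw.1 hy hw.2 ⟨e, he, hwe, hye⟩⟩

theorem card_component_le (hx : x ∈ rest V F) (hxx : Adj E x x) :
    (component V E F x).card ≤ r := by
  classical
  obtain ⟨e, he, hxe, -⟩ := hxx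
  refine (Finset.card_le_card fun y hy => ?_).trans (hM.card_touched_le he)
  rw [mem_component] at hy
  exact Finset.mem_filter.2 ⟨hy.1, x, hx, hxe, hy.2.symm⟩

/-- The edges of `F` avoid `rest V F` and so survive. A deleted edge cuts no class of `F` but `rest
V F`, where its trace stays inside the component; so outside the component it separates nothing that
`F` leaves together. -/
theorem isTestCover_sdiff (hx : x ∈ rest V F) :
    IsTestCover (V \ component V E F x) (E.filter fun e => Disjoint e (component V E F x)) := by
  have hE := isTestCover_iff.1 hM.isTestCover
  have key : ∀ y ∈ V \ component V E F x, ∀ z ∈ V \ component V E F x,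
      Equiv (E.filter fun e => Disjoint e (component V E F x)) y z → ∀ e ∈ E, y ∈ e → z ∈ e := by
    intro y hy z hz hyz e he hye
    rw [Finset.mem_sdiff] at hy hz
    by_cases hd : Disjoint e (component V E F x)
    · exact (hyz e (Finset.mem_filter.2 ⟨he, hd⟩)).1 hye
    · obtain ⟨w, hwe, hw⟩ := Finset.not_disjoint_iff.1 hd
      by_contra hze
      have hF : Equiv F y z := fun f hf => hyz f <| Finset.mem_filter.2
        ⟨hM.subset hf, Finset.disjoint_left.2 fun a haf ha =>
          (mem_rest.1 (mem_component.1 ha).1).2 f hf haf⟩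
      have := (hM.mem_rest_of_cut he (mem_component.1 hw).1 hwe hy.1 hz.1 hF hye hze).1
      exact hy.2 (hM.mem_component_of_meets hx he hw hwe this hye)
  exact isTestCover_iff.2 fun y hy z hz hyz =>
    hE y (Finset.mem_sdiff.1 hy).1 z (Finset.mem_sdiff.1 hz).1 fun e he =>
      ⟨key y hy z hz hyz e he, key z hz y hy hyz.symm e he⟩

/-- There is a separating edge that stays away from the components met by few given edges. -/
theorem exists_fresh (hx : x ∈ rest V F) (hP : P ⊆ E) (hc : P.card < 4 * k)
    (hN : 4 * k * r ≤ (sepComps V E F u v).card)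
    (hmeet : ∃ e ∈ P, ¬Disjoint e (component V E F x)) :
    ∃ g ∈ E, SepOn F g u v ∧ (∃ w ∈ rest V F, w ∈ g) ∧ Disjoint g (component V E F x) ∧
      ∀ w ∈ rest V F, w ∈ g → ∀ e ∈ P, w ∉ e := by
  classical
  -- Fewer than `4 * k` edges touch components with fewer than `4 * k * r` vertices in all, so some
  -- component in `sepComps` is untouched.
  obtain ⟨s, hs, hsP⟩ : ∃ s ∈ sepComps V E F u v, s ∉ P.biUnion fun e =>
      (rest V F).filter fun x => ∃ y ∈ rest V F, y ∈ e ∧ Adj E x y := by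
    by_contra hcon
    push Not at hcon
    have h1 := (Finset.card_le_card hcon).trans (Finset.card_biUnion_le_card_mul P _ r
      fun e he => hM.card_touched_le (hP he))
    have h2 := Nat.mul_lt_mul_of_pos_right hc hM.one_le_r
    omega
  obtain ⟨hs, g, hg, hsep, t, ht, htg, hst⟩ := mem_sepComps.1 hs
  have hfar : ∀ e ∈ P, ∀ y ∈ rest V F, y ∈ e → ¬Adj E s y := fun e he y hy hye hsy =>
    hsP (Finset.mem_biUnion.2 ⟨e, he, Finset.mem_filter.2 ⟨hs, y, hy, hye, hsy⟩⟩)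
  have hnear : ∀ w ∈ rest V F, w ∈ g → Adj E s w := fun w hw hwg =>
    hM.adj_trans hs ht hw hst ⟨g, hg, htg, hwg⟩
  refine ⟨g, hg, hsep, ⟨t, ht, htg⟩, ?_, fun w hw hwg e he hwe => hfar e he w hw hwe
    (hnear w hw hwg)⟩
  refine Finset.disjoint_left.2 fun w hwg hw => ?_
  obtain ⟨e, he, hmeet⟩ := hmeet
  obtain ⟨y, hye, hy⟩ := Finset.not_disjoint_iff.1 hmeet
  have hw := mem_component.1 hw
  have hy := mem_component.1 hy
  exact hfar e he y hy.1 hye (hM.adj_trans hs hw.1 hy.1 (hnear w hw.1 hwg)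
    (hM.adj_trans hw.1 hx hy.1 hw.2.symm hy.2))

/-- On the component together with a vertex `o` of `rest V F` outside it and uncovered by `T`, only
the edges meeting the component act. Being laminar, they give at most one class each besides that of
`o`, and the class of `o` already occurs outside the component. -/
theorem cls_le_cls_sdiff_add (hx : x ∈ rest V F) (hxx : Adj E x x) {T : Finset (Finset ℕ)}
    (hT : T ⊆ E) (hc : T.card + 1 < 4 * k) :
    cls V T ≤ cls (V \ component V E F x) T +
      (T.filter fun e => ¬Disjoint e (component V E F x)).card := by
  classical
  set X := component V E F x with hX
  set R := T.filter fun e => ¬Disjoint e X with hR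
  have hXr : X.card ≤ r := hM.card_component_le hx hxx
  have hXrest : X ⊆ rest V F := Finset.filter_subset _ _
  obtain ⟨o, ho, hoT⟩ := exists_uncovered (A := rest V F \ X) (r := r)
    (fun e he => hM.edge_card_le e (hT he)) (by
      rw [Finset.card_sdiff_of_subset hXrest]
      have h1 := Nat.mul_lt_mul_of_pos_right hc hM.one_le_r
      have h2 := hM.le_card_rest
      rw [add_mul] at h1
      omega)
  obtain ⟨ho, hoX⟩ := Finset.mem_sdiff.1 ho
  have h1 : cls (insert o X) T ≤ R.card + 1 := by
    have h2 : cls (insert o X) T ≤ cls (insert o X) (R ∪ ∅) :=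
      cls_le_cls subset_rfl fun y hy z hz hyz e he => by
        by_cases hd : Disjoint e X
        · have key : ∀ y ∈ insert o X, y ∉ e := fun y hy => by
            rcases Finset.mem_insert.1 hy with rfl | hy
            · exact hoT e he
            · exact fun hye => Finset.disjoint_left.1 hd hye hy
          exact iff_of_false (key y hy) (key z hz)
        · exact hyz e (Finset.mem_union_left _ (Finset.mem_filter.2 ⟨he, hd⟩))
    have h3 := cls_union_le_of_compatible (insert o X) ∅ R
      (fun e he a ha b hb c hc d hd _ _ _ _ _ _ f hf => by simp at hf)
      (fun e he e' he' a ha b hb c hc d hd _ _ _ hae hae' hbe hbe' hce hce' _ _ => by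
        have hmem : ∀ y ∈ insert o X, y ∈ rest V F := fun y hy => by
          rcases Finset.mem_insert.1 hy with rfl | hy
          exacts [ho, hXrest hy]
        exact hM.laminar (hT (Finset.mem_filter.1 he).1) (hT (Finset.mem_filter.1 he').1)
          (hmem a ha) (hmem b hb) (hmem c hc) hae hae' hbe hbe' hce hce')
    have h4 : cls (insert o X) ∅ ≤ 1 := cls_le_one fun y _ z _ e he => by simp at he
    omega
  have hV : V.image (fun v => T.filter (v ∈ ·)) ⊆ (V \ X).image (fun v => T.filter (v ∈ ·)) ∪
      ((insert o X).image fun v => T.filter (v ∈ ·)).erase (T.filter (o ∈ ·)) := by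
    intro s hs
    obtain ⟨y, hy, rfl⟩ := Finset.mem_image.1 hs
    by_cases hyX : y ∈ X
    · by_cases hyo : T.filter (y ∈ ·) = T.filter (o ∈ ·)
      · rw [hyo]
        exact Finset.mem_union_left _ (Finset.mem_image_of_mem (fun v => T.filter (v ∈ ·))
          (Finset.mem_sdiff.2 ⟨(mem_rest.1 ho).1, hoX⟩))
      · exact Finset.mem_union_right _ (Finset.mem_erase.2 ⟨hyo,
          Finset.mem_image_of_mem (fun v => T.filter (v ∈ ·)) (Finset.mem_insert_of_mem hyX)⟩)
    · exact Finset.mem_union_left _ (Finset.mem_image_of_mem (fun v => T.filter (v ∈ ·))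
        (Finset.mem_sdiff.2 ⟨hy, hyX⟩))
  have h5 := (Finset.card_le_card hV).trans (Finset.card_union_le _ _)
  rw [Finset.card_erase_of_mem (Finset.mem_image_of_mem (fun v => T.filter (v ∈ ·))
    (Finset.mem_insert_self o X))] at h5
  simp only [cls] at h1 ⊢
  omega

/-- A solution can be changed so that it avoids a component each of whose types of edges is
frequent. -/
theorem exists_avoiding (hx : x ∈ rest V F) (hxx : Adj E x x)
    (hfreq : ∀ u ∈ V, ∀ v ∈ V, x ∈ sepComps V E F u v → 4 * k * r ≤ (sepComps V E F u v).card)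
    {T : Finset (Finset ℕ)} (hT : T ⊆ E) (hTk : T.card + 2 ≤ 2 * k) (hTc : T.card + k ≤ cls V T) :
    ∃ H ⊆ E.filter fun e => Disjoint e (component V E F x),
      H.card + k ≤ cls (V \ component V E F x) H := by
  classical
  have hred := hM.cls_le_cls_sdiff_add hx hxx hT (by omega)
  set X := component V E F x with hX
  set R := T.filter fun e => ¬Disjoint e X with hR
  set T₁ := T.filter fun e => Disjoint e X with hT₁
  have hsplit : T₁.card + R.card = T.card := Finset.card_filter_add_card_filter_not _
  have hXr : X.card ≤ r := hM.card_component_le hx hxx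
  have hXrest : X ⊆ rest V F := Finset.filter_subset _ _
  -- `B` does the work of `T₁` outside `X`, and each of its edges pays for itself.
  obtain ⟨B, hB, hBeq, hBc⟩ := exists_independent_subset (V \ X) ∅ T₁
  simp only [Finset.empty_union] at hBeq hBc
  have hout : ∀ P ⊆ E, P.card + 1 < 4 * k → ∃ o ∈ rest V F, o ∉ X ∧ ∀ e ∈ P, o ∉ e := by
    intro P hP hc
    obtain ⟨o, ho, hoP⟩ := exists_uncovered (A := rest V F \ X) (r := r)
      (fun e he => hM.edge_card_le e (hP he)) (by
        rw [Finset.card_sdiff_of_subset hXrest]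
        have h1 := Nat.mul_lt_mul_of_pos_right hc hM.one_le_r
        have h2 := hM.le_card_rest
        rw [add_mul] at h1
        omega)
    exact ⟨o, (Finset.mem_sdiff.1 ho).1, (Finset.mem_sdiff.1 ho).2, hoP⟩
  have hBT : B ⊆ T := hB.trans (Finset.filter_subset _ _)
  have hmemV : ∀ {y}, y ∈ rest V F → y ∉ X → y ∈ V \ X := fun hy hyX =>
    Finset.mem_sdiff.2 ⟨(mem_rest.1 hy).1, hyX⟩
  -- `G` collects replacement edges. Over `T` it gains at least one class per edge; `B ∪ G` has
  -- excess at least `j`, each unit beyond the first costing at most two edges. At `j = k`, `B ∪ G`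
  -- is a solution, unless one was found earlier.
  have key : ∀ j, 1 ≤ j → j ≤ k → (∃ H ⊆ E.filter fun e => Disjoint e X,
        H.card + k ≤ cls (V \ X) H) ∨
      ∃ G ⊆ E.filter fun e => Disjoint e X, G.card + 2 ≤ 2 * j ∧
        T₁.card + k + G.card ≤ cls (V \ X) (T ∪ G) ∧
        B.card + G.card + j ≤ cls (V \ X) (B ∪ G) := by
    intro j hj
    induction j, hj using Nat.le_induction with
    | base =>
      intro _
      refine .inr ⟨∅, Finset.empty_subset _, by simp, ?_, ?_⟩
      · rw [Finset.union_empty, Finset.card_empty]; omega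
      · obtain ⟨o, ho, hoX, -⟩ := hout ∅ (Finset.empty_subset _) (by
          rw [Finset.card_empty]; have := hM.one_le_k; omega)
        have := cls_pos (F := ∅) ⟨o, hmemV ho hoX⟩
        rw [Finset.union_empty, Finset.card_empty]; omega
    | succ j hj ih =>
      intro hjk
      obtain h | ⟨G, hG, hGc, hTG, hBG⟩ := ih (by omega)
      · exact .inl h
      have hGE : G ⊆ E := hG.trans (Finset.filter_subset _ _)
      have hBX : B ⊆ E.filter fun e => Disjoint e X := fun e he => by
        have := Finset.mem_filter.1 (hB he)
        exact Finset.mem_filter.2 ⟨hT this.1, this.2⟩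
      -- If the edges of `R` cut no class of `B ∪ G`, then `B ∪ G` has all the classes of `T ∪ G`,
      -- and is a solution because `B.card ≤ T₁.card`.
      by_cases hdone : ∀ y ∈ V \ X, ∀ z ∈ V \ X, Equiv (B ∪ G) y z → ∀ e ∈ R, y ∈ e → z ∈ e
      · refine .inl ⟨B ∪ G, Finset.union_subset hBX hG, ?_⟩
        have h1 : cls (V \ X) (T ∪ G) ≤ cls (V \ X) (B ∪ G) :=
          cls_le_cls subset_rfl fun y hy z hz hyz e he => by
            rcases Finset.mem_union.1 he with he | he
            · by_cases hd : Disjoint e X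
              · exact hBeq y hy z hz (hyz.mono Finset.subset_union_left) e
                  (Finset.mem_filter.2 ⟨he, hd⟩)
              · have heR : e ∈ R := Finset.mem_filter.2 ⟨he, hd⟩
                exact ⟨hdone y hy z hz hyz e heR, hdone z hz y hy hyz.symm e heR⟩
            · exact hyz e (Finset.mem_union_right _ he)
        have h2 := Finset.card_union_le B G
        have h3 : B.card ≤ T₁.card := Finset.card_le_card hB
        omega
      push Not at hdone
      obtain ⟨y, hy, z, hz, hyz, e, heR, hye, hze⟩ := hdone
      obtain ⟨heT, hed⟩ := Finset.mem_filter.1 heR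
      obtain ⟨y₀, hy₀e, hy₀⟩ := Finset.not_disjoint_iff.1 hed
      have hyV := Finset.mem_sdiff.1 hy
      have hzV := Finset.mem_sdiff.1 hz
      -- A vertex of `rest V F` in `e` would lie in `X`, which `e` meets. So `y` is covered by `F`
      -- and its membership counts in `SepOn`.
      have hyrest : y ∉ rest V F := fun h =>
        hyV.2 (hM.mem_component_of_meets hx (hT heT) hy₀ hy₀e h hye)
      have hycov : ∃ f ∈ F, y ∈ f := by
        by_contra hcon; push Not at hcon; exact hyrest (mem_rest.2 ⟨hyV.1, hcon⟩)
      have hsep : ∀ {v}, ¬(v ∈ e ∧ ∃ f ∈ F, v ∈ f) → x ∈ sepComps V E F y v := fun hv =>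
        mem_sepComps.2 ⟨hx, e, hT heT, fun h => hv (h.1 ⟨hye, hycov⟩), y₀,
          (mem_component.1 hy₀).1, hy₀e, (mem_component.1 hy₀).2⟩
      have hPE : T ∪ G ⊆ E := Finset.union_subset hT hGE
      have hPc := Finset.card_union_le T G
      have hmeet : ∀ {Q}, T ⊆ Q → ∃ e ∈ Q, ¬Disjoint e X := fun h => ⟨e, h heT, hed⟩
      have hnX : ∀ {g w}, Disjoint g X → w ∈ g → w ∉ X := fun h hw => Finset.disjoint_left.1 h hw
      have hBP : ∀ {w}, (∀ e ∈ T ∪ G, w ∉ e) → ∀ e ∈ B ∪ G, w ∉ e := fun h e he =>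
        h e (Finset.union_subset_union_left hBT he)
      -- If `y` is covered by `B ∪ G`, one fresh edge gains two classes: it cuts `y` from `z`, and
      -- also `w` from the untouched `o` in the different class of uncovered vertices.
      by_cases hcov : ∃ h ∈ B ∪ G, y ∈ h
      · obtain ⟨h, hh, hyh⟩ := hcov
        obtain ⟨g, hgE, hgsep, ⟨w, hw, hwg⟩, hgX, hgP⟩ := hM.exists_fresh hx hPE (by omega)
          (hfreq y hyV.1 z hzV.1 (hsep fun h => hze h.1)) (hmeet Finset.subset_union_left)
        have hcut : ¬(y ∈ g ↔ z ∈ g) := by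
          intro hiff
          -- `SepOn` disregards `z` when it lies in `rest V F`; then freshness excludes `z` from
          -- `g`, since `z` lies in `h`.
          by_cases hzr : z ∈ rest V F
          · have hzh : z ∈ h := (hyz h hh).1 hyh
            have hzg : z ∉ g := fun hzg =>
              hgP z hzr hzg h (Finset.union_subset_union_left hBT hh) hzh
            exact hgsep (iff_of_false (fun h => hzg (hiff.1 h.1)) fun h => hzg h.1)
          · have hzcov : ∃ f ∈ F, z ∈ f := by
              by_contra hcon; push Not at hcon; exact hzr (mem_rest.2 ⟨hzV.1, hcon⟩)
            exact hgsep (and_congr hiff (iff_of_true hycov hzcov))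
        obtain ⟨o, ho, hoX, hoP⟩ := hout (insert g (T ∪ G)) (Finset.insert_subset hgE hPE)
          ((Nat.add_le_add_right (Finset.card_insert_le _ _) 1).trans_lt (by omega))
        simp only [Finset.forall_mem_insert] at hoP
        have hwP := hgP w hw hwg
        have hwV := hmemV hw (hnX hgX hwg)
        have hoV := hmemV ho hoX
        have g1 := cls_add_one_le (Finset.subset_insert g (T ∪ G)) hwV hoV
          (fun e he => iff_of_false (hwP e he) (hoP.2 e he)) (not_equiv_insert hwg hoP.1)
        have g2 := cls_add_two_le (Finset.subset_insert g (B ∪ G)) hy hz hwV hoV hyz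
          (fun h => hcut (equiv_insert.1 h).1)
          (fun e he => iff_of_false (hBP hwP e he) (hBP hoP.2 e he))
          (not_equiv_insert hwg hoP.1) (fun heq => hBP hwP h hh ((heq h hh).1 hyh))
        have c1 := Finset.card_insert_le g G
        refine .inr ⟨insert g G, Finset.insert_subset (Finset.mem_filter.2 ⟨hgE, hgX⟩) hG,
          by omega, ?_, ?_⟩ <;> rw [Finset.union_insert] <;> omega
      -- Now `y` shares the class of all vertices uncovered by `B ∪ G`. Separating `y` from `c` in
      -- `rest V F` forces `y` into the edge, so two fresh edges both contain `y` and cut this class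
      -- into four, with `w`, `w'`, `y`, `o` in the parts: three classes for two edges.
      · push Not at hcov
        obtain ⟨c, hc, -⟩ := hout ∅ (Finset.empty_subset _) (by
          rw [Finset.card_empty]; have := hM.one_le_k; omega)
        have hccov : ∀ {g : Finset ℕ}, ¬(c ∈ g ∧ ∃ f ∈ F, c ∈ f) := fun ⟨_, f, hf, hcf⟩ =>
          (mem_rest.1 hc).2 f hf hcf
        have hN := hfreq y hyV.1 c (mem_rest.1 hc).1 (hsep hccov)
        have hyg : ∀ {g}, SepOn F g y c → y ∈ g := fun hs => by
          by_contra hn; exact hs (iff_of_false (fun h => hn h.1) hccov)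
        obtain ⟨g, hgE, hgsep, ⟨w, hw, hwg⟩, hgX, hgP⟩ := hM.exists_fresh hx hPE (by omega)
          hN (hmeet Finset.subset_union_left)
        have hPE' : insert g (T ∪ G) ⊆ E := Finset.insert_subset hgE hPE
        have hPc' := Finset.card_insert_le g (T ∪ G)
        obtain ⟨g', hgE', hgsep', ⟨w', hw', hwg'⟩, hgX', hgP'⟩ := hM.exists_fresh hx hPE'
          (by omega) hN (hmeet (Finset.subset_union_left.trans (Finset.subset_insert _ _)))
        obtain ⟨o, ho, hoX, hoP⟩ := hout (insert g' (insert g (T ∪ G)))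
          (Finset.insert_subset hgE' hPE')
          ((Nat.add_le_add_right (Finset.card_insert_le _ _) 1).trans_lt (by omega))
        simp only [Finset.forall_mem_insert] at hoP hgP'
        have hwP := hgP w hw hwg
        have hwP' := hgP' w' hw' hwg'
        have hwg'' : w ∉ g' := fun h => (hgP' w hw h).1 hwg
        have hwV := hmemV hw (hnX hgX hwg)
        have hwV' := hmemV hw' (hnX hgX' hwg')
        have hoV := hmemV ho hoX
        have hy1 := hyg hgsep
        have hy2 := hyg hgsep'
        have g1 := cls_add_one_le (Finset.subset_insert g (T ∪ G)) hwV hoV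
          (fun e he => iff_of_false (hwP e he) (hoP.2.2 e he)) (not_equiv_insert hwg hoP.2.1)
        have g2 := cls_add_one_le (Finset.subset_insert g' (insert g (T ∪ G))) hwV' hoV
          (by rw [equiv_insert]
              exact ⟨iff_of_false hwP'.1 hoP.2.1,
                fun e he => iff_of_false (hwP'.2 e he) (hoP.2.2 e he)⟩)
          (not_equiv_insert hwg' hoP.1)
        have g3 := cls_add_one_le (Finset.subset_insert g (B ∪ G)) hwV hoV
          (fun e he => iff_of_false (hBP hwP e he) (hBP hoP.2.2 e he))
          (not_equiv_insert hwg hoP.2.1)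
        have g4 := cls_add_two_le (Finset.subset_insert g' (insert g (B ∪ G))) hwV hy hwV' hoV
          (by rw [equiv_insert]
              exact ⟨iff_of_true hwg hy1, fun e he => iff_of_false (hBP hwP e he) (hcov e he)⟩)
          (not_equiv_insert' hwg'' hy2)
          (by rw [equiv_insert]
              exact ⟨iff_of_false hwP'.1 hoP.2.1,
                fun e he => iff_of_false (hBP hwP'.2 e he) (hBP hoP.2.2 e he)⟩)
          (not_equiv_insert hwg' hoP.1) (not_equiv_insert hwg hwP'.1)
        have c1 := Finset.card_insert_le g G
        have c2 := Finset.card_insert_le g' (insert g G)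
        refine .inr ⟨insert g' (insert g G), Finset.insert_subset (Finset.mem_filter.2
          ⟨hgE', hgX'⟩) (Finset.insert_subset (Finset.mem_filter.2 ⟨hgE, hgX⟩) hG),
          by omega, ?_, ?_⟩ <;> rw [Finset.union_insert, Finset.union_insert] <;> omega
  obtain h | ⟨G, hG, -, -, hBG⟩ := key k hM.one_le_k le_rfl
  · exact h
  · refine ⟨B ∪ G, Finset.union_subset (fun e he => ?_) hG, ?_⟩
    · have := Finset.mem_filter.1 (hB he)
      exact Finset.mem_filter.2 ⟨hT this.1, this.2⟩
    · have := Finset.card_union_le B G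
      omega

/-- Removal of a component each of whose types of edges is frequent does not change the answer. -/
theorem removal_iff (hx : x ∈ rest V F) (hxx : Adj E x x)
    (hfreq : ∀ u ∈ V, ∀ v ∈ V, x ∈ sepComps V E F u v → 4 * k * r ≤ (sepComps V E F u v).card) :
    (∃ H ⊆ E.filter fun e => Disjoint e (component V E F x),
      H.card + k ≤ cls (V \ component V E F x) H) ↔ ∃ T ⊆ E, T.card + k ≤ cls V T := by
  constructor
  · rintro ⟨H, hH, hle⟩
    exact ⟨H, hH.trans (Finset.filter_subset _ _), hle.trans
      (cls_le_cls Finset.sdiff_subset fun _ _ _ _ h => h)⟩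
  · rintro ⟨T, hT, hle⟩
    obtain ⟨T', hT', h1, h2⟩ := exists_small_subset hM.one_le_k hle
    exact hM.exists_avoiding hx hxx hfreq (hT'.trans hT) h1 h2

/-- `SepOn` counts only covered vertices, and an edge meeting `rest V F` cuts no class of covered
ones. Hence testing representatives of the classes suffices. -/
theorem sepComps_congr (hy : y ∈ V) (hz : z ∈ V) (h : Equiv F y z) :
    sepComps V E F y v = sepComps V E F z v := by
  classical
  have key : ∀ e ∈ E, ∀ w ∈ rest V F, w ∈ e → ∀ y ∈ V, ∀ z ∈ V, Equiv F y z →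
      (y ∈ e ∧ ∃ f ∈ F, y ∈ f) → z ∈ e ∧ ∃ f ∈ F, z ∈ f := by
    rintro e he w hw hwe y hy z hz h ⟨hye, f, hf, hyf⟩
    refine ⟨by_contra fun hze => ?_, f, hf, (h f hf).1 hyf⟩
    exact (mem_rest.1 (hM.mem_rest_of_cut he hw hwe hy hz h hye hze).1).2 f hf hyf
  ext x
  simp only [mem_sepComps]
  refine and_congr_right fun hx => exists_congr fun e => and_congr_right fun he =>
    and_congr_left fun ⟨w, hw, hwe, _⟩ => not_congr (iff_congr ?_ Iff.rfl)
  exact ⟨key e he w hw hwe y hy z hz h, key e he w hw hwe z hz y hy h.symm⟩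

omit hM in
theorem sepComps_comm : sepComps V E F u v = sepComps V E F v u := by
  classical
  ext x
  simp only [mem_sepComps, SepOn, iff_comm]

end LocallyMaximal

/-! ### The algorithm -/

/-- Membership of a vertex in a list. -/
def memB (v : ℕ) (l : List ℕ) : Bool := l.any fun w => eqNat v w

/-- No edge in the list `F` separates `u` and `v`. -/
def sameB (F : List (List ℕ)) (u v : ℕ) : Bool := F.all fun e => !(Bool.xor (memB u e) (memB v e))

/-- A list of representatives with respect to a relation. -/
def dedupBy {α : Type} (s : α → α → Bool) (l : List α) : List α :=
  l.foldl (fun acc v => bif acc.any (s v) then acc else v :: acc) []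

/-- Representatives of the classes into which `F` divides `V`. -/
def reps (V : List ℕ) (F : List (List ℕ)) : List ℕ := dedupBy (sameB F) V

/-- The lists of one or two edges. -/
def cands (E : List (List ℕ)) : List (List (List ℕ)) :=
  E.map (fun e => [e]) ++ (E.map fun e => E.map fun e' => [e, e']).flatten

/-- The length of a list in unary. -/
def ticks {α : Type} (l : List α) : List Bool := l.map fun _ => true

/-- There are at least as many classes as edges in `F` and elements of `κ` together. -/
def manyClasses (V : List ℕ) (κ : List Bool) (F : List (List ℕ)) : Bool :=
  lenLe (ticks F ++ κ) (reps V F)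

/-- There are few classes so far, and adding `c` creates more classes than it has edges. -/
def improves (V : List ℕ) (κ : List Bool) (F c : List (List ℕ)) : Bool :=
  !manyClasses V κ F && !lenLe (reps V (c ++ F)) (ticks (reps V F) ++ ticks c)

/-- Local search, adding one or two edges at a time. -/
def greedy (V : List ℕ) (E : List (List ℕ)) (κ : List Bool) : List (List ℕ) :=
  κ.foldl (fun F _ => ((cands E).filter (improves V κ F)).headI ++ F) []

def coveredB (F : List (List ℕ)) (v : ℕ) : Bool := F.any fun e => memB v e

def restL (V : List ℕ) (F : List (List ℕ)) : List ℕ := V.filter fun v => !coveredB F v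

def adjB (E : List (List ℕ)) (x y : ℕ) : Bool := E.any fun e => memB x e && memB y e

def sepB (F : List (List ℕ)) (u v : ℕ) (e : List ℕ) : Bool :=
  Bool.xor (memB u e && coveredB F u) (memB v e && coveredB F v)

def sepCompsL (C : List ℕ) (E F : List (List ℕ)) (u v : ℕ) : List ℕ :=
  C.filter fun x => E.any fun e => sepB F u v e && C.any fun y => memB y e && adjB E x y

/-- The component of `x` can be removed: all types of edges that meet it are frequent. -/
def removableB (R C : List ℕ) (E F : List (List ℕ)) (K : List Bool) (x : ℕ) : Bool :=
  adjB E x x && R.all fun u => R.all fun v =>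
    !memB x (sepCompsL C E F u v) || lenLe K (sepCompsL C E F u v)

/-- The number with the given binary digits in unary, up to a bound. -/
def unary (N : List ℕ) (b : List Bool) : List Bool :=
  b.reverse.foldl (fun acc b => bif lenLe N acc then acc else
    bif b then true :: (acc ++ acc) else acc ++ acc) []

/-- Descriptions of instances: vertices, edges, parameter. -/
abbrev Code := List ℕ × List (List ℕ) × ℕ

/-- Writing `k` in unary could take exponential time. Doubling stops once the length reaches `|V| +
1`, beyond which the exact value is irrelevant. -/
def param (z : Code) : List Bool := unary (0 :: z.1) z.2.2.bits

def localMax (z : Code) : List (List ℕ) := greedy z.1 z.2.1 (param z)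

def yesTest (z : Code) : Bool := manyClasses z.1 (param z) (localMax z)

def threshold (r : ℕ) (z : Code) : List Bool := (List.replicate (4 * r) (param z)).flatten

/-- The first removable component. -/
def toRemove (r : ℕ) (z : Code) : List ℕ :=
  bif yesTest z then [] else bif lenLe (threshold r z) (restL z.1 (localMax z)) then
    (((restL z.1 (localMax z)).filter (removableB (reps z.1 (localMax z)) (restL z.1 (localMax z))
      z.2.1 (localMax z) (threshold r z))).map
        fun x => (restL z.1 (localMax z)).filter (adjB z.2.1 x)).headI
  else []

def restrict (z : Code) (X : List ℕ) : Code :=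
  (z.1.filter fun v => !memB v X, z.2.1.filter fun e => !e.any fun v => memB v X, z.2.2)

def reduceStep (r : ℕ) (z : Code) : Code := restrict z (toRemove r z)

def sameSet (e e' : List ℕ) : Bool := (e.all fun v => memB v e') && e'.all fun v => memB v e

/-- A small instance with answer Yes. -/
def yesInstance (z : Code) : Code :=
  (reps z.1 (localMax z), dedupBy sameSet ((localMax z).map fun e =>
    e.filter fun v => memB v (reps z.1 (localMax z))), z.2.2)

def finish (z : Code) : Code := bif yesTest z then yesInstance z else z

/-- Every effective step removes a vertex, so as many rounds as vertices are enough. -/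
def kernelize (r : ℕ) (z : Code) : Code := finish (z.1.foldl (fun s _ => reduceStep r s) z)

/-! ### Its running time -/

namespace PolyTime

variable {α γ : Type} [Enc α] [Enc γ]

theorem memB {v : γ → ℕ} {l : γ → List ℕ} (hv : PolyTime v) (hl : PolyTime l) :
    PolyTime fun c => memB (v c) (l c) := any hl (eqNat (hv.comp id.fst) id.snd)

theorem sameB {F : γ → List (List ℕ)} {u v : γ → ℕ} (hF : PolyTime F) (hu : PolyTime u)
    (hv : PolyTime v) : PolyTime fun c => sameB (F c) (u c) (v c) :=
  all hF (not (xor (memB (hu.comp id.fst) id.snd) (memB (hv.comp id.fst) id.snd)))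

theorem dedupBy {s : γ → α → α → Bool} {f : γ → List α} (hf : PolyTime f)
    (hs : PolyTime fun z : γ × α × α => s z.1 z.2.1 z.2.2) :
    PolyTime fun c => dedupBy (s c) (f c) := by
  obtain ⟨q, hq⟩ := hf.sz_le
  have h : PolyTime fun z : γ × List α × α => z.2.1.any (s z.1 z.2.2) :=
    any id.snd.fst (hs.comp (f := fun w : (γ × List α × α) × α => (w.1.1, w.1.2.2, w.2))
      (prod id.fst.fst (prod id.fst.snd.snd id.snd)))
  refine foldl_add hf nil (s := fun c acc v => bif acc.any (s c v) then acc else v :: acc)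
    (cond h id.snd.fst (cons id.snd.snd id.snd.fst)) q fun c b a ha => ?_
  have h1 := sz_le_of_mem ha
  have h2 := hq c
  cases b.any (s c a)
  · rw [cond_false, sz_cons]; omega
  · rw [cond_true]; omega

theorem reps {V : γ → List ℕ} {F : γ → List (List ℕ)} (hV : PolyTime V) (hF : PolyTime F) :
    PolyTime fun c => reps (V c) (F c) :=
  dedupBy hV (sameB (hF.comp id.fst) id.snd.fst id.snd.snd)

theorem cands {E : γ → List (List ℕ)} (hE : PolyTime E) : PolyTime fun c => cands (E c) :=
  append (map hE (cons id.snd nil)) (flatten (map hE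
    (map (hE.comp id.fst) (cons id.fst.snd (cons id.snd nil)))))

theorem ticks {l : γ → List α} (hl : PolyTime l) : PolyTime fun c => ticks (l c) := map hl true

theorem manyClasses {V : γ → List ℕ} {κ : γ → List Bool} {F : γ → List (List ℕ)}
    (hV : PolyTime V) (hκ : PolyTime κ) (hF : PolyTime F) :
    PolyTime fun c => manyClasses (V c) (κ c) (F c) := lenLe (append (ticks hF) hκ) (reps hV hF)

theorem improves {V : γ → List ℕ} {κ : γ → List Bool} {F l : γ → List (List ℕ)}
    (hV : PolyTime V) (hκ : PolyTime κ) (hF : PolyTime F) (hl : PolyTime l) :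
    PolyTime fun c => improves (V c) (κ c) (F c) (l c) :=
  and (not (manyClasses hV hκ hF)) (not (lenLe (reps hV (append hl hF)) (append (ticks (reps hV hF)) (ticks hl))))

theorem greedy {V : γ → List ℕ} {E : γ → List (List ℕ)} {κ : γ → List Bool}
    (hV : PolyTime V) (hE : PolyTime E) (hκ : PolyTime κ) :
    PolyTime fun c => greedy (V c) (E c) (κ c) := by
  obtain ⟨q, hq⟩ := (cands hE).sz_le
  refine foldl_add hκ nil
    (s := fun c F _ => ((TestCover.cands (E c)).filter (TestCover.improves (V c) (κ c) F)).headI ++ F)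
    (append (headI rfl (filter (cands (hE.comp id.fst)) (improves (hV.comp id.fst.fst)
      (hκ.comp id.fst.fst) id.fst.snd.fst id.snd))) id.snd.fst) q fun c F _ _ => ?_
  have h1 := sz_append (((TestCover.cands (E c)).filter
    (TestCover.improves (V c) (κ c) F)).headI) F
  have h2 : sz (((TestCover.cands (E c)).filter (TestCover.improves (V c) (κ c) F)).headI) ≤
      sz (TestCover.cands (E c)) := by
    cases h : (TestCover.cands (E c)).filter (TestCover.improves (V c) (κ c) F) with
    | nil => exact sz_pos _
    | cons a l =>
      have : a ∈ (TestCover.cands (E c)).filter (TestCover.improves (V c) (κ c) F) := by simp [h]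
      exact (sz_le_of_mem (List.mem_filter.1 this).1).le
  have h3 := hq c
  omega

theorem coveredB {F : γ → List (List ℕ)} {v : γ → ℕ} (hF : PolyTime F) (hv : PolyTime v) :
    PolyTime fun c => coveredB (F c) (v c) := any hF (memB (hv.comp id.fst) id.snd)

theorem restL {V : γ → List ℕ} {F : γ → List (List ℕ)} (hV : PolyTime V) (hF : PolyTime F) :
    PolyTime fun c => restL (V c) (F c) := filter hV (not (coveredB (hF.comp id.fst) id.snd))

theorem adjB {E : γ → List (List ℕ)} {x y : γ → ℕ} (hE : PolyTime E) (hx : PolyTime x)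
    (hy : PolyTime y) : PolyTime fun c => adjB (E c) (x c) (y c) :=
  any hE (and (memB (hx.comp id.fst) id.snd) (memB (hy.comp id.fst) id.snd))

theorem sepB {F : γ → List (List ℕ)} {u v : γ → ℕ} {e : γ → List ℕ} (hF : PolyTime F)
    (hu : PolyTime u) (hv : PolyTime v) (he : PolyTime e) :
    PolyTime fun c => sepB (F c) (u c) (v c) (e c) :=
  xor (and (memB hu he) (coveredB hF hu)) (and (memB hv he) (coveredB hF hv))

theorem sepCompsL {C : γ → List ℕ} {E F : γ → List (List ℕ)} {u v : γ → ℕ} (hC : PolyTime C)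
    (hE : PolyTime E) (hF : PolyTime F) (hu : PolyTime u) (hv : PolyTime v) :
    PolyTime fun c => sepCompsL (C c) (E c) (F c) (u c) (v c) :=
  filter hC (any (hE.comp id.fst) (and (sepB (hF.comp id.fst.fst) (hu.comp id.fst.fst)
    (hv.comp id.fst.fst) id.snd) (any (hC.comp id.fst.fst) (and (memB id.snd id.fst.snd)
      (adjB (hE.comp id.fst.fst.fst) id.fst.fst.snd id.snd)))))

theorem removableB {R C : γ → List ℕ} {E F : γ → List (List ℕ)} {K : γ → List Bool} {x : γ → ℕ}
    (hR : PolyTime R) (hC : PolyTime C) (hE : PolyTime E) (hF : PolyTime F) (hK : PolyTime K)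
    (hx : PolyTime x) : PolyTime fun c => removableB (R c) (C c) (E c) (F c) (K c) (x c) := by
  have h : PolyTime fun z : (γ × ℕ) × ℕ =>
      TestCover.sepCompsL (C z.1.1) (E z.1.1) (F z.1.1) z.1.2 z.2 :=
    sepCompsL (hC.comp id.fst.fst) (hE.comp id.fst.fst) (hF.comp id.fst.fst) id.fst.snd id.snd
  exact and (adjB hE hx hx) (all hR (all (hR.comp id.fst)
    (or (not (memB (hx.comp id.fst.fst) h)) (lenLe (hK.comp id.fst.fst) h))))

theorem unary {N : γ → List ℕ} {b : γ → List Bool} (hN : PolyTime N) (hb : PolyTime b) :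
    PolyTime fun c => unary (N c) (b c) := by
  obtain ⟨q, hq⟩ := hN.sz_le
  -- Only an accumulator shorter than `N` is doubled, whence a bound independent of the number of
  -- digits.
  have key : ∀ (N : List ℕ) (m acc : List Bool), sz acc ≤ 8 * sz N →
      sz (m.foldl (fun acc b => bif TestCover.lenLe N acc then acc else
        bif b then Bool.true :: (acc ++ acc) else acc ++ acc) acc) ≤ 8 * sz N := by
    intro N m
    have hlen : ∀ l : List Bool, sz l ≤ 4 * l.length + 1 := by
      intro l
      induction l with
      | nil => exact le_rfl
      | cons b l ih => have := sz_bool_le b; rw [sz_cons, List.length_cons]; omega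
    induction m with
    | nil => exact fun acc h => h
    | cons b m ih =>
      intro acc h
      refine ih _ ?_
      cases hN : TestCover.lenLe N acc
      · have h1 : acc.length < N.length := by
          rw [← not_le, ← lenLe_iff, hN]; exact Bool.false_ne_true
        have h2 := length_lt_sz N
        have h3 := sz_append acc acc
        have h4 := hlen acc
        cases b
        · simp only [hN, cond_false]; omega
        · simp only [hN, cond_false, cond_true, sz_cons]
          have := sz_bool_le Bool.true
          omega
      · simpa only [hN, cond_true] using h
  refine foldl (reverse hb) nil (s := fun c acc b => bif TestCover.lenLe (N c) acc then acc else
    bif b then Bool.true :: (acc ++ acc) else acc ++ acc)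
    (cond (lenLe (hN.comp id.fst) id.snd.fst) id.snd.fst (cond id.snd.snd
      (cons true (append id.snd.fst id.snd.fst)) (append id.snd.fst id.snd.fst))) (8 * q)
    fun c m _ => (key (N c) m [] ?_).trans ?_
  · have := sz_pos (N c); rw [sz_nil]; omega
  · simpa using hq c

theorem param : PolyTime param :=
  unary (cons ⟨.nil, .X, fun _ => RunsIn.nil.mono (by simp [sz])⟩ id.fst) (bits id.snd.snd)

theorem localMax : PolyTime localMax := greedy id.fst id.snd.fst param

theorem yesTest : PolyTime yesTest := manyClasses id.fst param localMax

theorem threshold (r : ℕ) : PolyTime (threshold r) := by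
  have : ∀ n, PolyTime fun z => (List.replicate n (TestCover.param z)).flatten := by
    intro n
    induction n with
    | zero => exact nil
    | succ n ih => simpa only [List.replicate_succ, List.flatten_cons] using append param ih
  exact this (4 * r)

theorem toRemove (r : ℕ) : PolyTime (toRemove r) := by
  have hC := restL (id (α := Code)).fst localMax
  refine cond yesTest nil (cond (lenLe (threshold r) hC) (headI rfl (map (filter hC
    (removableB (comp (reps id.fst localMax) id.fst) (hC.comp id.fst) id.fst.snd.fst
      (localMax.comp id.fst) ((threshold r).comp id.fst) id.snd))
    (filter (hC.comp id.fst) (adjB id.fst.fst.snd.fst id.fst.snd id.snd)))) nil)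

theorem reduceStep (r : ℕ) : PolyTime (reduceStep r) :=
  prod (filter id.fst (not (memB id.snd ((toRemove r).comp id.fst))))
    (prod (filter id.snd.fst (not (any id.snd (memB id.snd ((toRemove r).comp id.fst.fst)))))
      id.snd.snd)

theorem sameSet {e f : γ → List ℕ} (he : PolyTime e) (hf : PolyTime f) :
    PolyTime fun c => sameSet (e c) (f c) :=
  and (all he (memB id.snd (hf.comp id.fst))) (all hf (memB id.snd (he.comp id.fst)))

theorem yesInstance : PolyTime yesInstance :=
  prod (reps id.fst localMax) (prod (dedupBy (map localMax (filter id.snd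
    (memB id.snd (comp (reps id.fst localMax) id.fst.fst)))) (sameSet id.snd.fst id.snd.snd))
    id.snd.snd)

theorem finish : PolyTime finish := cond yesTest yesInstance id

/-- Steps only delete, which bounds every intermediate description in the loop of `kernelize`. -/
theorem sz_reduceStep_le (r : ℕ) (z : Code) : sz (TestCover.reduceStep r z) ≤ sz z := by
  obtain ⟨V, E, k⟩ := z
  have h1 : sz (V.filter fun v => !TestCover.memB v (TestCover.toRemove r (V, E, k))) ≤ sz V :=
    sz_sublist List.filter_sublist
  have h2 : sz (E.filter fun e => !e.any fun v =>
    TestCover.memB v (TestCover.toRemove r (V, E, k))) ≤ sz E := sz_sublist List.filter_sublist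
  simp only [TestCover.reduceStep, restrict, sz_prod]
  omega

theorem kernelize (r : ℕ) : PolyTime (kernelize r) := by
  refine comp (g := TestCover.finish) (f := fun z : Code =>
    z.1.foldl (fun s _ => TestCover.reduceStep r s) z) finish (foldl id.fst id (s := fun _ s _ => TestCover.reduceStep r s)
    ((reduceStep r).comp id.snd.fst) .X fun z m _ => ?_)
  have key : ∀ (m : List ℕ) (s : Code),
      sz (m.foldl (fun s _ => TestCover.reduceStep r s) s) ≤ sz s := by
    intro m
    induction m with
    | nil => exact fun s => le_rfl
    | cons a m ih => exact fun s => (ih _).trans (sz_reduceStep_le r s)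
  simpa using key m z

end PolyTime

/-! ### Counting -/

theorem card_image_le_of_cover {V S : Finset ℕ} {F : Finset (Finset ℕ)}
    (h : ∀ v ∈ V, ∃ s ∈ S, Equiv F v s) : cls V F ≤ S.card := by
  refine (Finset.card_le_card ?_).trans (Finset.card_image_le (s := S)
    (f := fun v => F.filter (v ∈ ·)))
  intro s hs
  obtain ⟨v, hv, rfl⟩ := Finset.mem_image.1 hs
  obtain ⟨s, hs, h⟩ := h v hv
  exact Finset.mem_image.2 ⟨s, hs, filter_mem_eq_iff.2 h.symm⟩

theorem card_sdiff_rest_le {V : Finset ℕ} {F : Finset (Finset ℕ)} {r : ℕ}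
    (hr : ∀ e ∈ F, e.card ≤ r) : (V \ rest V F).card ≤ F.card * r := by
  refine (Finset.card_le_card fun v hv => ?_).trans
    (Finset.card_biUnion_le_card_mul F (fun e => e) r hr)
  rw [Finset.mem_sdiff, mem_rest] at hv
  by_contra hn
  exact hv.2 ⟨hv.1, fun e he hve => hn (Finset.mem_biUnion.2 ⟨e, he, hve⟩)⟩

/-- Swapping matches the two halves of the off-diagonal. Counting unordered pairs saves the factor
two that the constant 18 requires. -/
theorem two_mul_card_lt_pairs (S : Finset ℕ) :
    2 * ((S ×ˢ S).filter fun p => p.1 < p.2).card + S.card = S.card * S.card := by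
  have h1 := Finset.card_filter_add_card_filter_not (s := S.offDiag) (fun p => p.1 < p.2)
  have h2 : S.offDiag.filter (fun p => p.1 < p.2) = (S ×ˢ S).filter fun p => p.1 < p.2 := by
    ext ⟨a, b⟩
    simp only [Finset.mem_filter, Finset.mem_offDiag, Finset.mem_product]
    constructor
    · rintro ⟨⟨h1, h2, -⟩, h3⟩; exact ⟨⟨h1, h2⟩, h3⟩
    · rintro ⟨⟨h1, h2⟩, h3⟩; exact ⟨⟨h1, h2, h3.ne⟩, h3⟩
  have h3 : (S.offDiag.filter fun p => ¬p.1 < p.2).card =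
      ((S ×ˢ S).filter fun p => p.1 < p.2).card := by
    refine Finset.card_bij (fun p _ => p.swap) ?_ (fun a _ b _ h => Prod.swap_injective h) ?_
    · rintro ⟨a, b⟩ h
      simp only [Finset.mem_filter, Finset.mem_offDiag, Finset.mem_product, Prod.swap] at h ⊢
      exact ⟨⟨h.1.2.1, h.1.1⟩, by omega⟩
    · rintro ⟨a, b⟩ h
      simp only [Finset.mem_filter, Finset.mem_product] at h
      exact ⟨(b, a), by
        simp only [Finset.mem_filter, Finset.mem_offDiag]; exact ⟨⟨h.1.2, h.1.1, by omega⟩, by omega⟩, rfl⟩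
  rw [h2, h3, Finset.offDiag_card] at h1
  have := Nat.le_mul_self S.card
  omega

/-- If no component can be removed, then there are few vertices. -/
theorem LocallyMaximal.card_lt {V S : Finset ℕ} {E F : Finset (Finset ℕ)} {k r : ℕ}
    (hM : LocallyMaximal V E F k r) (hF : F.card ≤ 2 * k) (hS : S.card < 3 * k)
    (hnon : ∀ x ∈ rest V F, Adj E x x → ∃ u ∈ S, ∃ v ∈ S, x ∈ sepComps V E F u v ∧
      (sepComps V E F u v).card < 4 * k * r) : V.card < 18 * k ^ 3 * r := by
  classical
  have hk := hM.one_le_k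
  have hr := hM.one_le_r
  have h1 : V.card ≤ (V \ rest V F).card + (rest V F).card := by
    have hsub : rest V F ⊆ V := Finset.filter_subset _ _
    exact (Finset.card_sdiff_add_card_eq_card hsub).ge
  have h2 : (V \ rest V F).card ≤ F.card * r :=
    card_sdiff_rest_le fun e he => hM.edge_card_le e (hM.subset he)
  have h3 := Finset.card_filter_add_card_filter_not (s := rest V F) (fun x => Adj E x x)
  -- Two vertices in no edge could not be separated by `E`.
  have h4 : ((rest V F).filter fun x => ¬Adj E x x).card ≤ 1 := by
    refine Finset.card_le_one.2 fun a ha b hb => ?_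
    obtain ⟨ha, ha'⟩ := Finset.mem_filter.1 ha
    obtain ⟨hb, hb'⟩ := Finset.mem_filter.1 hb
    exact isTestCover_iff.1 hM.isTestCover a (mem_rest.1 ha).1 b (mem_rest.1 hb).1 fun e he =>
      iff_of_false (fun h => ha' ⟨e, he, h, h⟩) fun h => hb' ⟨e, he, h, h⟩
  have h5 : ((rest V F).filter fun x => Adj E x x).card ≤
      ((S ×ˢ S).filter fun p => p.1 < p.2).card * (4 * k * r) := by
    refine (Finset.card_le_card fun x hx => ?_).trans (Finset.card_biUnion_le_card_mul _
      (fun p => if (sepComps V E F p.1 p.2).card < 4 * k * r then sepComps V E F p.1 p.2 else ∅)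
      _ fun p _ => ?_)
    · obtain ⟨hx, hxx⟩ := Finset.mem_filter.1 hx
      obtain ⟨u, hu, v, hv, hxN, hN⟩ := hnon x hx hxx
      rw [Finset.mem_biUnion]
      rcases lt_trichotomy u v with h | h | h
      · exact ⟨(u, v), Finset.mem_filter.2 ⟨Finset.mk_mem_product hu hv, h⟩,
          by simp only; rwa [if_pos hN]⟩
      · obtain ⟨-, e, -, hs, -⟩ := mem_sepComps.1 hxN
        exact absurd (by rw [h]) hs
      · rw [LocallyMaximal.sepComps_comm] at hxN hN
        exact ⟨(v, u), Finset.mem_filter.2 ⟨Finset.mk_mem_product hv hu, h⟩,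
          by simp only; rwa [if_pos hN]⟩
    · split_ifs with h
      · exact h.le
      · simp
  have h6 := two_mul_card_lt_pairs S
  set p := ((S ×ˢ S).filter fun p => p.1 < p.2).card
  -- From `2 * p = S.card * (S.card - 1)` and `S.card ≤ 3 * k - 1`.
  have h7 : 2 * p ≤ (3 * k - 1) * (3 * k - 2) := by
    obtain ⟨m, rfl⟩ : ∃ m, k = m + 1 := ⟨k - 1, by omega⟩
    have e1 : 3 * (m + 1) - 1 = 3 * m + 2 := by omega
    have e2 : 3 * (m + 1) - 2 = 3 * m + 1 := by omega
    rw [e1, e2]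
    have hs : S.card ≤ 3 * m + 2 := by omega
    rcases Nat.eq_zero_or_pos S.card with h0 | h0
    · rw [h0] at h6
      have : p = 0 := by omega
      rw [this]; exact Nat.zero_le _
    · obtain ⟨s, hs'⟩ : ∃ s, S.card = s + 1 := ⟨S.card - 1, by omega⟩
      rw [hs'] at h6 hs
      have : s ≤ 3 * m + 1 := by omega
      nlinarith
  obtain ⟨m, rfl⟩ : ∃ m, k = m + 1 := ⟨k - 1, by omega⟩
  have e1 : 3 * (m + 1) - 1 = 3 * m + 2 := by omega
  have e2 : 3 * (m + 1) - 2 = 3 * m + 1 := by omega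
  rw [e1, e2] at h7
  have h8 : F.card * r ≤ 2 * (m + 1) * r := Nat.mul_le_mul_right r hF
  have h9 : 2 * p * (2 * (m + 1) * r) ≤ (3 * m + 2) * (3 * m + 1) * (2 * (m + 1) * r) :=
    Nat.mul_le_mul_right _ h7
  have h10 : V.card ≤ 2 * (m + 1) * r + 1 + (3 * m + 2) * (3 * m + 1) * (2 * (m + 1) * r) := by
    have : p * (4 * (m + 1) * r) = 2 * p * (2 * (m + 1) * r) := by ring
    omega
  -- The slack absorbs the possible isolated vertex and still leaves the inequality strict.
  have h11 : 18 * (m + 1) ^ 3 * r = (2 * (m + 1) * r +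
      (3 * m + 2) * (3 * m + 1) * (2 * (m + 1) * r)) + (18 * m ^ 2 + 30 * m + 12) * r := by ring
  have h12 : 12 ≤ (18 * m ^ 2 + 30 * m + 12) * r :=
    (Nat.le_mul_of_pos_right 12 hr).trans (Nat.mul_le_mul_right r (Nat.le_add_left _ _))
  omega

/-- An edge is determined by a filling of `r` slots, each empty or holding a vertex. -/
theorem card_edges_le {V : Finset ℕ} {E : Finset (Finset ℕ)} {r : ℕ} (hE : ∀ e ∈ E, e ⊆ V)
    (hr : ∀ e ∈ E, e.card ≤ r) : E.card ≤ (V.card + 1) ^ r := by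
  have h : E ⊆ (Fintype.piFinset fun _ : Fin r => Finset.insertNone V).image fun f =>
      Finset.eraseNone (Finset.univ.image f) := by
    intro e he
    refine Finset.mem_image.2 ⟨fun i => e.toList[(i : ℕ)]?, ?_, ?_⟩
    · refine Fintype.mem_piFinset.2 fun i => Finset.mem_insertNone.2 fun a ha => ?_
      exact hE e he (Finset.mem_toList.1 (List.mem_of_getElem? ha))
    · ext x
      rw [Finset.mem_eraseNone, Finset.mem_image, ← Finset.mem_toList, List.mem_iff_getElem?]
      constructor
      · rintro ⟨i, -, hi⟩
        exact ⟨i, hi⟩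
      · rintro ⟨i, hi⟩
        obtain ⟨hlt, -⟩ := List.getElem?_eq_some_iff.1 hi
        rw [Finset.length_toList] at hlt
        exact ⟨⟨i, hlt.trans_le (hr e he)⟩, Finset.mem_univ _, hi⟩
  refine (Finset.card_le_card h).trans (Finset.card_image_le.trans ?_)
  simp

/-! ### Correctness -/

/-- The set of the sets of elements of the lists. -/
def toFs (F : List (List ℕ)) : Finset (Finset ℕ) := (F.map List.toFinset).toFinset

section

variable {V : List ℕ} {E F : List (List ℕ)} {κ : List Bool} {e : List ℕ} {u v x : ℕ}

theorem exists_mem_toFs {p : Finset ℕ → Prop} : (∃ f ∈ toFs F, p f) ↔ ∃ e ∈ F, p e.toFinset := by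
  simp [toFs]

theorem forall_mem_toFs {p : Finset ℕ → Prop} : (∀ f ∈ toFs F, p f) ↔ ∀ e ∈ F, p e.toFinset := by
  simp [toFs]

theorem mem_toFs (h : e ∈ F) : e.toFinset ∈ toFs F :=
  List.mem_toFinset.2 (List.mem_map_of_mem h)

theorem toFs_cons : toFs (e :: F) = insert e.toFinset (toFs F) := by simp [toFs]

theorem card_toFs_le : (toFs F).card ≤ F.length :=
  (List.toFinset_card_le _).trans_eq (List.length_map _)

theorem memB_iff : memB v e = true ↔ v ∈ e := by
  simp [memB, eqNat_iff]

theorem sameB_iff : sameB F u v = true ↔ Equiv (toFs F) u v := by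
  simp only [sameB, List.all_eq_true, Equiv, forall_mem_toFs, List.mem_toFinset]
  refine forall₂_congr fun e _ => ?_
  rw [← memB_iff, ← memB_iff]
  cases memB u e <;> cases memB v e <;> simp

theorem coveredB_iff : coveredB F v = true ↔ ∃ f ∈ toFs F, v ∈ f := by
  simp [coveredB, exists_mem_toFs, memB_iff]

theorem adjB_iff : adjB E u v = true ↔ Adj (toFs E) u v := by
  simp [adjB, Adj, exists_mem_toFs, memB_iff]

theorem sepB_iff : sepB F u v e = true ↔ SepOn (toFs F) e.toFinset u v := by
  simp only [SepOn, List.mem_toFinset, ← coveredB_iff, ← memB_iff, sepB]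
  cases memB u e <;> cases memB v e <;> cases coveredB F u <;> cases coveredB F v <;> simp

theorem mem_restL : v ∈ restL V F ↔ v ∈ rest V.toFinset (toFs F) := by
  rw [restL, List.mem_filter, mem_rest, List.mem_toFinset, Bool.not_eq_true', ← Bool.not_eq_true,
    coveredB_iff]
  simp

theorem mem_sepCompsL : x ∈ sepCompsL (restL V F) E F u v ↔
    x ∈ sepComps V.toFinset (toFs E) (toFs F) u v := by
  simp only [sepCompsL, List.mem_filter, mem_sepComps, mem_restL, exists_mem_toFs,
    List.any_eq_true, Bool.and_eq_true, sepB_iff, adjB_iff, memB_iff, List.mem_toFinset]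

theorem length_restL (hV : V.Nodup) : (restL V F).length = (rest V.toFinset (toFs F)).card := by
  rw [← List.toFinset_card_of_nodup (l := restL V F) (hV.filter _)]
  congr 1; ext; rw [List.mem_toFinset, ← mem_restL]

theorem length_sepCompsL (hV : V.Nodup) : (sepCompsL (restL V F) E F u v).length =
    (sepComps V.toFinset (toFs E) (toFs F) u v).card := by
  rw [← List.toFinset_card_of_nodup (l := sepCompsL (restL V F) E F u v)
    ((hV.filter _).filter _)]
  congr 1; ext; rw [List.mem_toFinset, ← mem_sepCompsL]

theorem dedupBy_spec {α : Type} {s : α → α → Bool} (hs : ∀ a, s a a = true) (l : List α) :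
    (∀ a ∈ dedupBy s l, a ∈ l) ∧ (∀ a ∈ l, ∃ b ∈ dedupBy s l, s a b = true) ∧
      (dedupBy s l).Pairwise fun a b => s a b = false := by
  have key : ∀ (l acc : List α), (acc.Pairwise fun a b => s a b = false) →
      ∃ m, m = l.foldl (fun acc v => bif acc.any (s v) then acc else v :: acc) acc ∧
        (∀ a ∈ m, a ∈ l ∨ a ∈ acc) ∧ (∀ a ∈ acc, a ∈ m) ∧ (∀ a ∈ l, ∃ b ∈ m, s a b = true) ∧
        m.Pairwise fun a b => s a b = false := by
    intro l
    induction l with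
    | nil => exact fun acc h => ⟨acc, rfl, fun a ha => .inr ha, fun a ha => ha, by simp, h⟩
    | cons v l ih =>
      intro acc h
      rw [List.foldl_cons]
      cases hv : acc.any (s v)
      · have hv' : ∀ b ∈ acc, s v b = false := by simpa using hv
        obtain ⟨m, hm, h1, h2, h3, h4⟩ := ih (v :: acc) (List.pairwise_cons.2 ⟨hv', h⟩)
        refine ⟨m, hm, fun a ha => ?_, fun a ha => h2 a (List.mem_cons_of_mem v ha), fun a ha => ?_,
          h4⟩
        · have := h1 a ha
          simp only [List.mem_cons] at this ⊢; tauto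
        · rcases List.mem_cons.1 ha with rfl | ha
          exacts [⟨a, h2 a List.mem_cons_self, hs a⟩, h3 a ha]
      · obtain ⟨m, hm, h1, h2, h3, h4⟩ := ih acc h
        refine ⟨m, hm, fun a ha => ?_, h2, fun a ha => ?_, h4⟩
        · have := h1 a ha
          simp only [List.mem_cons] at this ⊢; tauto
        · rcases List.mem_cons.1 ha with rfl | ha
          · obtain ⟨b, hb, hab⟩ := List.any_eq_true.1 hv
            exact ⟨b, h2 b hb, hab⟩
          · exact h3 a ha
  obtain ⟨m, hm, h1, -, h3, h4⟩ := key l [] List.Pairwise.nil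
  rw [dedupBy, ← hm]
  exact ⟨fun a ha => by simpa using h1 a ha, h3, h4⟩

end

/-! ### Representatives, the unary parameter and the greedy search. -/

section

variable {V : List ℕ} {E F : List (List ℕ)} {κ : List Bool} {e : List ℕ} {u v x : ℕ}

theorem sameB_self (F : List (List ℕ)) (v : ℕ) : sameB F v v = true :=
  sameB_iff.2 (Equiv.refl _ v)

theorem mem_of_mem_reps (h : v ∈ reps V F) : v ∈ V := (dedupBy_spec (sameB_self F) V).1 v h

theorem exists_mem_reps (h : v ∈ V) : ∃ s ∈ reps V F, Equiv (toFs F) v s :=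
  let ⟨s, hs, hvs⟩ := (dedupBy_spec (sameB_self F) V).2.1 v h; ⟨s, hs, sameB_iff.1 hvs⟩

theorem reps_pairwise : (reps V F).Pairwise fun a b => ¬Equiv (toFs F) a b :=
  (dedupBy_spec (sameB_self F) V).2.2.imp fun h h' => by rw [sameB_iff.2 h'] at h; cases h

theorem nodup_reps : (reps V F).Nodup := by
  refine (reps_pairwise (F := F)).imp fun {a b} h h' => ?_
  subst h'
  exact h (Equiv.refl _ _)

theorem eq_of_mem_reps (hu : u ∈ reps V F) (hv : v ∈ reps V F) (h : Equiv (toFs F) u v) : u = v := by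
  by_contra hne
  have : Std.Symm fun a b => ¬Equiv (toFs F) a b := ⟨fun _ _ h h' => h h'.symm⟩
  exact (reps_pairwise (F := F)).forall hu hv hne h

theorem length_reps : (reps V F).length = cls V.toFinset (toFs F) := by
  rw [← List.toFinset_card_of_nodup nodup_reps]
  refine le_antisymm (card_le_cls (fun v hv => ?_) fun u hu v hv => ?_)
    (card_image_le_of_cover fun v hv => ?_)
  · exact List.mem_toFinset.2 (mem_of_mem_reps (List.mem_toFinset.1 hv))
  · exact eq_of_mem_reps (List.mem_toFinset.1 hu) (List.mem_toFinset.1 hv)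
  · obtain ⟨s, hs, h⟩ := exists_mem_reps (F := F) (List.mem_toFinset.1 hv)
    exact ⟨s, List.mem_toFinset.2 hs, h⟩

theorem manyClasses_iff : manyClasses V κ F = true ↔
    F.length + κ.length ≤ cls V.toFinset (toFs F) := by
  simp [manyClasses, lenLe_iff, length_reps, ticks]

/-- When doubling stops, the number read so far has also reached `N.length`, and further digits
cannot decrease it. -/
theorem length_unary (N : List ℕ) (n : ℕ) : (unary N n.bits).length = n ∨
    N.length ≤ (unary N n.bits).length ∧ N.length ≤ n := by
  have key : ∀ b : List Bool, (unary N b).length = b.foldr Nat.bit 0 ∨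
      N.length ≤ (unary N b).length ∧ N.length ≤ b.foldr Nat.bit 0 := by
    intro b
    simp only [unary, List.foldl_reverse]
    induction b with
    | nil => exact .inl rfl
    | cons b l ih =>
      simp only [List.foldr_cons]
      generalize List.foldr _ [] l = acc at ih ⊢
      generalize List.foldr Nat.bit 0 l = m at ih ⊢
      have hm := Nat.bit_val b m
      cases h : lenLe N acc
      · have h1 : acc.length < N.length := by
          rw [← not_le, ← lenLe_iff, h]; exact Bool.false_ne_true
        cases b <;> simp at hm ⊢ <;> omega
      · have h1 := lenLe_iff.1 h
        right
        simp only [cond_true]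
        refine ⟨h1, ?_⟩
        cases b <;> simp only [Bool.toNat_false, Bool.toNat_true] at hm <;> omega
  simpa only [foldr_bits] using key n.bits

/-- After `m` rounds, either no candidate improves or the excess of classes over edges is at least
`m`. A stalled search has either enough classes already or a locally maximal set. -/
theorem greedy_spec (V : List ℕ) (E : List (List ℕ)) (κ : List Bool) :
    (∀ e ∈ greedy V E κ, e ∈ E) ∧ (greedy V E κ).length ≤ 2 * κ.length ∧
      ((greedy V E κ).length + κ.length ≤ cls V.toFinset (toFs (greedy V E κ)) ∨
        ∀ c ∈ cands E, cls V.toFinset (toFs (c ++ greedy V E κ)) ≤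
          cls V.toFinset (toFs (greedy V E κ)) + c.length) := by
  have hcand : ∀ c ∈ cands E, (∀ e ∈ c, e ∈ E) ∧ c.length ≤ 2 := by
    intro c hc
    simp only [cands, List.mem_append, List.mem_map, List.mem_flatten] at hc
    rcases hc with ⟨e, he, rfl⟩ | ⟨l, ⟨e, he, rfl⟩, hc⟩
    · simpa using he
    · obtain ⟨e', he', rfl⟩ := List.mem_map.1 hc
      simpa using ⟨he, he'⟩
  let next : List (List ℕ) → List (List ℕ) := fun F =>
    ((cands E).filter (improves V κ F)).headI ++ F
  have hgreedy : greedy V E κ = next^[κ.length] [] := List.foldl_const next [] κ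
  have key : ∀ m, (∀ e ∈ next^[m] [], e ∈ E) ∧ (next^[m] []).length ≤ 2 * m ∧
      ((cands E).filter (improves V κ (next^[m] [])) = [] ∨
        (next^[m] []).length + m ≤ (reps V (next^[m] [])).length) := by
    intro m
    induction m with
    | zero =>
      refine ⟨by simp, by simp, .inr ?_⟩
      simp
    | succ m ih =>
      obtain ⟨h1, h2, h3⟩ := ih
      rw [Function.iterate_succ_apply']
      generalize next^[m] [] = F at h1 h2 h3 ⊢
      cases h : (cands E).filter (improves V κ F) with
      | nil =>
        -- `headI` of the empty list is `[]`, so a stalled search stays put.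
        have hF : next F = F := by simp only [next, h]; rfl
        rw [hF]
        exact ⟨h1, by omega, .inl h⟩
      | cons c l =>
        have hF : next F = c ++ F := by simp [next, h]
        have hc : c ∈ (cands E).filter (improves V κ F) := by simp [h]
        obtain ⟨hc, himp⟩ := List.mem_filter.1 hc
        obtain ⟨hcE, hc2⟩ := hcand c hc
        have h3 : F.length + m ≤ (reps V F).length := h3.resolve_left (by simp [h])
        simp only [improves, Bool.and_eq_true, Bool.not_eq_true', ← Bool.not_eq_true,
          lenLe_iff, ticks, List.length_append, List.length_map] at himp
        rw [hF]
        refine ⟨fun e he => ?_, ?_, .inr ?_⟩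
        · rcases List.mem_append.1 he with he | he
          exacts [hcE e he, h1 e he]
        · rw [List.length_append]; omega
        · rw [List.length_append]; omega
  rw [hgreedy]
  obtain ⟨h1, h2, h3⟩ := key κ.length
  refine ⟨h1, h2, ?_⟩
  generalize next^[κ.length] [] = F at h1 h2 h3 ⊢
  rcases h3 with h3 | h3
  · by_cases hm : manyClasses V κ F = true
    · exact .inl (manyClasses_iff.1 hm)
    · refine .inr fun c hc => ?_
      have := List.filter_eq_nil_iff.1 h3 c hc
      simp only [improves, Bool.eq_false_of_not_eq_true hm, Bool.not_false, Bool.true_and,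
        Bool.not_eq_true', Bool.not_eq_false, lenLe_iff, ticks, List.length_append,
        List.length_map, length_reps] at this
      exact this
  · rw [length_reps] at h3
    exact .inl h3

theorem sameSet_iff {e e' : List ℕ} : sameSet e e' = true ↔ e.toFinset = e'.toFinset := by
  simp only [sameSet, Bool.and_eq_true, List.all_eq_true, memB_iff, Finset.ext_iff,
    List.mem_toFinset]
  exact ⟨fun h a => ⟨h.1 a, h.2 a⟩, fun h => ⟨fun a => (h a).1, fun a => (h a).2⟩⟩

end

/-- The lists describe the instance. -/
def Describes {r : ℕ} (z : Code) (I : Problem r) : Prop :=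
  z.1.Nodup ∧ z.1.toFinset = I.V ∧ (∀ e ∈ z.2.1, e.Nodup) ∧ (z.2.1.map List.toFinset).Nodup ∧
    toFs z.2.1 = I.E ∧ z.2.2 = I.k

theorem isCode_iff {r : ℕ} {I : Problem r} {d : Data} :
    I.IsCode d ↔ ∃ z : Code, Describes z I ∧ d = enc z := by
  constructor
  · rintro ⟨vs, es, h1, h2, h3, h4, h5, h6⟩
    exact ⟨(vs, es, I.k), ⟨h1, h2, h3, h4, h5, rfl⟩, h6⟩
  · rintro ⟨⟨vs, es, k⟩, ⟨h1, h2, h3, h4, h5, h6⟩, h7⟩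
    simp only at h6
    subst h6
    exact ⟨vs, es, h1, h2, h3, h4, h5, h7⟩

theorem Problem.isYes_iff {r : ℕ} (I : Problem r) :
    I.IsYes ↔ ∃ F ⊆ I.E, F.card + I.k ≤ cls I.V F := exists_isTestCover_iff I.isTestCover

theorem restrict_nil (z : Code) : restrict z [] = z := by
  have h : ∀ v, memB v [] = false := fun _ => rfl
  have h' : ∀ e : List ℕ, (e.any fun _ => false) = false := fun e => by simp
  simp only [restrict, h, h', Bool.not_false, List.filter_true]

theorem card_localMax_le (z : Code) : (toFs (localMax z)).card ≤ 2 * (param z).length :=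
  card_toFs_le.trans (greedy_spec z.1 z.2.1 (param z)).2.1

/-! ### Invariance of the answer and the final bounds. -/

namespace Describes

variable {r : ℕ} {z : Code} {I : Problem r} (h : Describes z I)

include h

theorem param_spec : (param z).length = I.k ∨
    I.V.card < (param z).length ∧ I.V.card < I.k := by
  have h1 := length_unary (0 :: z.1) z.2.2
  rw [List.length_cons, ← List.toFinset_card_of_nodup h.1, h.2.1, ← param, h.2.2.2.2.2] at h1
  exact h1

theorem localMax_subset : toFs (localMax z) ⊆ I.E := by
  rw [← h.2.2.2.2.1]
  exact forall_mem_toFs.2 fun e he => mem_toFs ((greedy_spec z.1 z.2.1 (param z)).1 e he)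

theorem yesTest_iff : yesTest z = true ↔
    (localMax z).length + (param z).length ≤ cls I.V (toFs (localMax z)) := by
  rw [yesTest, manyClasses_iff, h.2.1]

/-- A truncated parameter exceeds `|V|`, which no number of classes does. -/
theorem param_eq_of_yesTest (hy : yesTest z = true) : (param z).length = I.k := by
  have h1 := h.yesTest_iff.1 hy
  have h2 : cls I.V (toFs (localMax z)) ≤ I.V.card := cls_le_card
  have := h.param_spec
  omega

theorem locallyMaximal (hr : 1 ≤ r) (hy : yesTest z ≠ true)
    (hC : 4 * I.k * r ≤ (rest I.V (toFs (localMax z))).card) :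
    LocallyMaximal I.V I.E (toFs (localMax z)) I.k r := by
  have hc : ∀ c ∈ cands z.2.1, cls z.1.toFinset (toFs (c ++ localMax z)) ≤
      cls z.1.toFinset (toFs (localMax z)) + c.length :=
    (greedy_spec z.1 z.2.1 (param z)).2.2.resolve_left fun h' => hy (manyClasses_iff.2 h')
  rw [h.2.1] at hc
  refine ⟨I.edge_subset, I.edge_card_le, I.isTestCover, h.localMax_subset, ?_, ?_, hC,
    I.one_le_k, hr⟩
  · rw [← h.2.2.2.2.1]
    refine forall_mem_toFs.2 fun e he => ?_
    have := hc [e] (by simp [cands, he])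
    simpa only [List.cons_append, List.nil_append, toFs_cons, List.length_cons, List.length_nil]
      using this
  · rw [← h.2.2.2.2.1]
    refine forall_mem_toFs.2 fun e he => forall_mem_toFs.2 fun e' he' => ?_
    have := hc [e, e'] (by simp [cands, he, he'])
    simpa only [List.cons_append, List.nil_append, toFs_cons, List.length_cons, List.length_nil]
      using this

/-- Removing the component of a vertex. -/
theorem restrict {F : Finset (Finset ℕ)} {x : ℕ} (hM : LocallyMaximal I.V I.E F I.k r)
    (hx : x ∈ rest I.V F) (hxx : Adj I.E x x)
    (hfreq : ∀ u ∈ I.V, ∀ v ∈ I.V, x ∈ sepComps I.V I.E F u v →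
      4 * I.k * r ≤ (sepComps I.V I.E F u v).card)
    {X : List ℕ} (hX : X.toFinset = component I.V I.E F x) :
    ∃ I' : Problem r, Describes (restrict z X) I' ∧ I'.k = I.k ∧ (I'.IsYes ↔ I.IsYes) ∧
      I'.V.card < I.V.card := by
  let I' : Problem r :=
    { V := I.V \ component I.V I.E F x
      E := I.E.filter fun e => Disjoint e (component I.V I.E F x)
      k := I.k
      edge_subset := fun e he => Finset.subset_sdiff.2
        ⟨I.edge_subset e (Finset.mem_filter.1 he).1, (Finset.mem_filter.1 he).2⟩
      edge_card_le := fun e he => I.edge_card_le e (Finset.mem_filter.1 he).1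
      isTestCover := hM.isTestCover_sdiff hx
      one_le_k := I.one_le_k }
  have hmem : ∀ v, v ∈ X ↔ v ∈ component I.V I.E F x := fun v => by rw [← hX, List.mem_toFinset]
  obtain ⟨h1, h2, h3, h4, h5, h6⟩ := h
  refine ⟨I', ⟨h1.filter _, ?_, fun e he => h3 e (List.mem_filter.1 he).1,
    h4.sublist (List.filter_sublist.map _), ?_, h6⟩, rfl, ?_, ?_⟩
  · ext v
    simp only [TestCover.restrict, I', List.mem_toFinset, List.mem_filter, Finset.mem_sdiff,
      ← hmem, Bool.not_eq_true', ← Bool.not_eq_true, memB_iff]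
    rw [← h2, List.mem_toFinset]
  · ext f
    simp only [I', Finset.mem_filter]
    rw [← show f ∈ toFs z.2.1 ↔ f ∈ I.E by rw [h5]]
    simp only [TestCover.restrict, toFs, List.mem_toFinset, List.mem_map, List.mem_filter,
      Bool.not_eq_true', ← Bool.not_eq_true, List.any_eq_true, memB_iff]
    constructor
    · rintro ⟨e, ⟨he, hd⟩, rfl⟩
      refine ⟨⟨e, he, rfl⟩, Finset.disjoint_left.2 fun v hv hvX => hd ⟨v, ?_, (hmem v).2 hvX⟩⟩
      exact List.mem_toFinset.1 hv
    · rintro ⟨⟨e, he, rfl⟩, hd⟩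
      exact ⟨e, ⟨he, fun ⟨v, hv, hvX⟩ => Finset.disjoint_left.1 hd (List.mem_toFinset.2 hv)
        ((hmem v).1 hvX)⟩, rfl⟩
  · rw [I'.isYes_iff, I.isYes_iff]
    exact hM.removal_iff hx hxx hfreq
  · refine Finset.card_lt_card (Finset.sdiff_ssubset (fun v hv => ?_) ⟨x, ?_⟩)
    · exact (mem_rest.1 (mem_component.1 hv).1).1
    · exact mem_component.2 ⟨hx, hxx⟩

theorem removableB_iff (hk : (param z).length = I.k) {x : ℕ} :
    removableB (reps z.1 (localMax z)) (restL z.1 (localMax z)) z.2.1 (localMax z)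
      (threshold r z) x = true ↔ Adj I.E x x ∧ ∀ u ∈ reps z.1 (localMax z),
        ∀ v ∈ reps z.1 (localMax z), x ∈ sepComps I.V I.E (toFs (localMax z)) u v →
          4 * I.k * r ≤ (sepComps I.V I.E (toFs (localMax z)) u v).card := by
  have ht : (threshold r z).length = 4 * I.k * r := by
    simp [threshold, hk]; ring
  simp only [removableB, Bool.and_eq_true, List.all_eq_true, Bool.or_eq_true, Bool.not_eq_true',
    ← Bool.not_eq_true, memB_iff, lenLe_iff, adjB_iff, mem_sepCompsL, length_sepCompsL h.1, ht,
    h.2.1, h.2.2.2.2.1, imp_iff_not_or]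

/-- The step is idle for one of three reasons: `yesTest` holds, no component is removable
(`LocallyMaximal.card_lt`), or `rest` is so small that a direct count bounds `V`. -/
theorem reduceStep (hr : 1 ≤ r) :
    (∃ I' : Problem r, Describes (reduceStep r z) I' ∧ I'.k = I.k ∧ (I'.IsYes ↔ I.IsYes) ∧
      I'.V.card < I.V.card) ∨
    (TestCover.reduceStep r z = z ∧ (I.V.card < 18 * I.k ^ 3 * r ∨ yesTest z = true)) := by
  have hk := I.one_le_k
  have hstay : toRemove r z = [] → TestCover.reduceStep r z = z := fun hn => by
    rw [TestCover.reduceStep, hn, restrict_nil]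
  by_cases hy : yesTest z = true
  · exact .inr ⟨hstay (by rw [toRemove, hy, cond_true]), .inr hy⟩
  have hfew : ¬_ ≤ _ := fun h' => hy (h.yesTest_iff.2 h')
  have hlr : (restL z.1 (localMax z)).length = (rest I.V (toFs (localMax z))).card := by
    rw [length_restL h.1, h.2.1]
  have ht : (threshold r z).length = 4 * (param z).length * r := by
    simp [threshold]; ring
  have hpow : I.k ≤ I.k ^ 3 := Nat.le_self_pow (by omega) _
  have hFc := card_localMax_le z
  have hrV : (rest I.V (toFs (localMax z))).card ≤ I.V.card :=
    Finset.card_le_card (Finset.filter_subset _ _)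
  by_cases hC : lenLe (threshold r z) (restL z.1 (localMax z)) = true
  · have hC' := lenLe_iff.1 hC
    rw [ht, hlr] at hC'
    -- A truncated parameter would exceed `|V|`, whereas the threshold, at least as long, fits into
    -- `rest`.
    have hpk : (param z).length = I.k := by
      have h1 := h.param_spec
      have h2 : (param z).length ≤ 4 * (param z).length * r :=
        (Nat.le_mul_of_pos_left _ (by omega)).trans (Nat.le_mul_of_pos_right _ hr)
      omega
    rw [hpk] at hC' hFc
    have hM := h.locallyMaximal hr hy hC'
    cases hl : (restL z.1 (localMax z)).filter (removableB (reps z.1 (localMax z))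
        (restL z.1 (localMax z)) z.2.1 (localMax z) (threshold r z)) with
    | nil =>
      refine .inr ⟨hstay (by simp only [toRemove, hl, hC, cond_true]; cases yesTest z <;> rfl), .inl ?_⟩
      refine hM.card_lt (S := (reps z.1 (localMax z)).toFinset) hFc ?_ fun x hx hxx => ?_
      · rw [List.toFinset_card_of_nodup nodup_reps, length_reps, h.2.1]
        have := (greedy_spec z.1 z.2.1 (param z)).2.1
        change (localMax z).length ≤ _ at this
        omega
      · have := List.filter_eq_nil_iff.1 hl x (mem_restL.2 (by rwa [h.2.1]))
        rw [h.removableB_iff hpk] at this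
        simp only [not_and, not_forall, not_le, exists_prop] at this
        obtain ⟨u, hu, v, hv, h1, h2⟩ := this hxx
        exact ⟨u, List.mem_toFinset.2 hu, v, List.mem_toFinset.2 hv, h1, h2⟩
    | cons x l =>
      left
      have hx : x ∈ (restL z.1 (localMax z)).filter (removableB (reps z.1 (localMax z))
        (restL z.1 (localMax z)) z.2.1 (localMax z) (threshold r z)) := by simp [hl]
      obtain ⟨hx, hrem⟩ := List.mem_filter.1 hx
      rw [mem_restL, h.2.1] at hx
      obtain ⟨hxx, hfreq⟩ := (h.removableB_iff hpk).1 hrem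
      have hX : toRemove r z = (restL z.1 (localMax z)).filter (adjB z.2.1 x) := by
        simp [toRemove, hl, hC, hy]
      refine h.restrict hM hx hxx (fun u hu v hv hxN => ?_) (X := toRemove r z) ?_
      -- The test ran over representatives only; `sepComps_congr` extends it to all pairs.
      · rw [← h.2.1] at hu hv
        obtain ⟨u', hu', huu⟩ := exists_mem_reps (F := localMax z) (List.mem_toFinset.1 hu)
        obtain ⟨v', hv', hvv⟩ := exists_mem_reps (F := localMax z) (List.mem_toFinset.1 hv)
        have hV : ∀ {v}, v ∈ reps z.1 (localMax z) → v ∈ I.V := fun hv => by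
          rw [← h.2.1]; exact List.mem_toFinset.2 (mem_of_mem_reps hv)
        rw [h.2.1] at hu hv
        have heq : sepComps I.V I.E (toFs (localMax z)) u v =
            sepComps I.V I.E (toFs (localMax z)) u' v' := by
          rw [hM.sepComps_congr hu (hV hu') huu, LocallyMaximal.sepComps_comm,
            hM.sepComps_congr hv (hV hv') hvv, LocallyMaximal.sepComps_comm]
        rw [heq] at hxN ⊢
        exact hfreq u' hu' v' hv' hxN
      · ext y
        rw [hX, List.mem_toFinset, List.mem_filter, mem_restL, adjB_iff, mem_component, h.2.1,
          h.2.2.2.2.1]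
  · refine .inr ⟨hstay (by simp [toRemove, hC]), .inl ?_⟩
    rw [lenLe_iff, ht, hlr, not_le] at hC
    -- With the exact parameter there are at most `2kr` covered and fewer than `4kr` uncovered
    -- vertices; with a truncated one, `|V| < k`.
    rcases h.param_spec with hp | hp
    · rw [hp] at hC hFc
      have h1 := card_sdiff_rest_le (V := I.V) (F := toFs (localMax z)) (r := r)
        fun e he => I.edge_card_le e (h.localMax_subset he)
      have hsub : rest I.V (toFs (localMax z)) ⊆ I.V := Finset.filter_subset _ _
      have h2 := Finset.card_sdiff_add_card_eq_card hsub
      have h3 := Nat.mul_le_mul_right r hFc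
      have h4 : 6 * I.k * r ≤ 18 * I.k ^ 3 * r := Nat.mul_le_mul_right r (by omega)
      have h5 : 6 * I.k * r = 2 * I.k * r + 4 * I.k * r := by ring
      omega
    · have h1 : 18 * I.k ^ 3 ≤ 18 * I.k ^ 3 * r := Nat.le_mul_of_pos_right _ hr
      omega

/-- Both answers are Yes. The traces of `localMax z` separate the representatives, merging equal
traces only saves edges, and the classes outnumber the edges by at least `k`. -/
theorem yesInstance (hr : 1 ≤ r) (hy : yesTest z = true) :
    ∃ I' : Problem r, Describes (yesInstance z) I' ∧ I'.k = I.k ∧ (I'.IsYes ↔ I.IsYes) ∧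
      I'.V.card < 18 * I.k ^ 3 * r := by
  have hk := I.one_le_k
  have hmany := h.yesTest_iff.1 hy
  have hpk := h.param_eq_of_yesTest hy
  have hFc := card_localMax_le z
  rw [hpk] at hmany hFc
  set R := reps z.1 (localMax z)
  set L := (localMax z).map fun e => e.filter fun v => memB v R with hL
  have hself : ∀ e : List ℕ, sameSet e e = true := fun e => sameSet_iff.2 rfl
  obtain ⟨hsub, hcov, hpw⟩ := dedupBy_spec hself L
  have hmemL : ∀ e ∈ dedupBy sameSet L, ∃ f ∈ localMax z, f.filter (fun v => memB v R) = e :=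
    fun e he => List.mem_map.1 (hsub e he)
  have hlocal : ∀ f ∈ localMax z, f ∈ z.2.1 := (greedy_spec z.1 z.2.1 (param z)).1
  have hRcard : R.toFinset.card = cls I.V (toFs (localMax z)) := by
    rw [List.toFinset_card_of_nodup nodup_reps, length_reps, h.2.1]
  let I' : Problem r :=
    { V := R.toFinset
      E := toFs (dedupBy sameSet L)
      k := I.k
      edge_subset := forall_mem_toFs.2 fun e he v hv => by
        obtain ⟨f, -, rfl⟩ := hmemL e he
        rw [List.mem_toFinset, List.mem_filter, memB_iff] at hv
        exact List.mem_toFinset.2 hv.2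
      edge_card_le := forall_mem_toFs.2 fun e he => by
        obtain ⟨f, hf, rfl⟩ := hmemL e he
        have hfE : f.toFinset ∈ I.E := by
          rw [← h.2.2.2.2.1]; exact mem_toFs (hlocal f hf)
        refine (Finset.card_le_card fun v hv => ?_).trans (I.edge_card_le _ hfE)
        rw [List.mem_toFinset] at hv ⊢
        exact (List.mem_filter.1 hv).1
      isTestCover := isTestCover_iff.2 fun x hx y hy hxy => by
        rw [List.mem_toFinset] at hx hy
        refine eq_of_mem_reps hx hy (forall_mem_toFs.2 fun f hf => ?_)
        obtain ⟨e, he, hfe⟩ := hcov (f.filter fun v => memB v R) (List.mem_map_of_mem hf)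
        have := forall_mem_toFs.1 hxy e he
        rw [← sameSet_iff.1 hfe] at this
        simpa only [List.mem_toFinset, List.mem_filter, memB_iff, hx, hy, and_true] using this
      one_le_k := I.one_le_k }
  refine ⟨I', ⟨nodup_reps, rfl, fun e he => ?_, ?_, rfl, h.2.2.2.2.2⟩, rfl,
    iff_of_true ?_ ?_, ?_⟩
  · obtain ⟨f, hf, rfl⟩ := hmemL e he
    exact (h.2.2.1 f (hlocal f hf)).filter _
  · refine List.pairwise_map.2 (hpw.imp fun hab hab' => ?_)
    rw [sameSet_iff.2 hab'] at hab; cases hab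
  · refine I'.isYes_iff.2 ⟨I'.E, subset_rfl, ?_⟩
    rw [cls_eq_card_iff.2 I'.isTestCover]
    have h1 : I'.E ⊆ toFs L := forall_mem_toFs.2 fun e he => mem_toFs (hsub e he)
    have h2 := (Finset.card_le_card h1).trans card_toFs_le
    rw [hL, List.length_map] at h2
    change _ + I.k ≤ R.toFinset.card
    omega
  · refine I.isYes_iff.2 ⟨_, h.localMax_subset, ?_⟩
    have := card_toFs_le (F := localMax z)
    omega
  · change R.toFinset.card < _
    -- All uncovered vertices share one class, so there are at most `2kr + 1` representatives.
    have h1 := card_sdiff_rest_le (V := I.V) (F := toFs (localMax z)) (r := r)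
      fun e he => I.edge_card_le e (h.localMax_subset he)
    have hsub : rest I.V (toFs (localMax z)) ⊆ I.V := Finset.filter_subset _ _
    have h2 := cls_union_le (V := I.V \ rest I.V (toFs (localMax z)))
      (A := rest I.V (toFs (localMax z))) (F := toFs (localMax z))
    rw [Finset.sdiff_union_of_subset hsub] at h2
    have h3 : cls (rest I.V (toFs (localMax z))) (toFs (localMax z)) ≤ 1 :=
      cls_le_one fun x hx y hy => LocallyMaximal.equiv_rest hx hy
    have h4 : cls (I.V \ rest I.V (toFs (localMax z))) (toFs (localMax z)) ≤ _ := cls_le_card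
    have h5 := Nat.mul_le_mul_right r hFc
    have hpow : I.k ≤ I.k ^ 3 := Nat.le_self_pow (by omega) _
    have h6 : 18 * I.k * r ≤ 18 * I.k ^ 3 * r := Nat.mul_le_mul_right r (by omega)
    have h7 : 18 * I.k * r = 2 * I.k * r + 16 * (I.k * r) := by ring
    have h8 : 1 ≤ I.k * r := Nat.mul_pos hk hr
    omega

theorem finish (hr : 1 ≤ r) (hz : I.V.card < 18 * I.k ^ 3 * r ∨ yesTest z = true) :
    ∃ I' : Problem r, Describes (finish z) I' ∧ I'.k = I.k ∧ (I'.IsYes ↔ I.IsYes) ∧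
      I'.V.card < 18 * I.k ^ 3 * r := by
  by_cases hy : yesTest z = true
  · rw [TestCover.finish, hy, cond_true]
    exact h.yesInstance hr hy
  · rw [TestCover.finish, Bool.eq_false_of_not_eq_true hy, cond_false]
    exact ⟨I, h, rfl, Iff.rfl, hz.resolve_right hy⟩

theorem iterate_reduceStep (hr : 1 ≤ r) (m : ℕ) :
    ∃ I' : Problem r, Describes ((TestCover.reduceStep r)^[m] z) I' ∧ I'.k = I.k ∧
      (I'.IsYes ↔ I.IsYes) ∧ (I'.V.card + m ≤ I.V.card ∨ I'.V.card < 18 * I'.k ^ 3 * r ∨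
        yesTest ((TestCover.reduceStep r)^[m] z) = true) := by
  induction m with
  | zero => exact ⟨I, h, rfl, Iff.rfl, .inl le_rfl⟩
  | succ m ih =>
    obtain ⟨I₁, h₁, hk₁, hy₁, hc₁⟩ := ih
    rw [Function.iterate_succ_apply']
    rcases h₁.reduceStep hr with ⟨I₂, h₂, hk₂, hy₂, hc₂⟩ | ⟨heq, hc₂⟩
    · refine ⟨I₂, h₂, hk₂.trans hk₁, hy₂.trans hy₁, ?_⟩
      rcases hc₁ with hc | hc | hc
      · exact .inl (by omega)
      · exact .inr (.inl (by rw [hk₂]; omega))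
      -- Once `yesTest` holds the step is the identity, so it cannot have removed a vertex.
      · left
        exfalso
        have : toRemove r ((TestCover.reduceStep r)^[m] z) = [] := by rw [toRemove, hc, cond_true]
        rw [TestCover.reduceStep, this, restrict_nil] at h₂
        have := h₁.2.1.symm.trans h₂.2.1
        rw [this] at hc₂
        omega
    · rw [heq]
      exact ⟨I₁, h₁, hk₁, hy₁, .inr hc₂⟩

theorem kernelize (hr : 1 ≤ r) :
    ∃ I' : Problem r, Describes (kernelize r z) I' ∧ I'.k = I.k ∧ (I'.IsYes ↔ I.IsYes) ∧
      I'.V.card < 18 * I.k ^ 3 * r := by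
  have hit : TestCover.kernelize r z =
      TestCover.finish ((TestCover.reduceStep r)^[z.1.length] z) := by
    rw [TestCover.kernelize, List.foldl_const]
  rw [hit]
  obtain ⟨I₁, h₁, hk₁, hy₁, hc₁⟩ := h.iterate_reduceStep hr z.1.length
  have hc : I₁.V.card < 18 * I₁.k ^ 3 * r ∨
      yesTest ((TestCover.reduceStep r)^[z.1.length] z) = true := by
    rcases hc₁ with hc | hc
    · left
      -- If every round removed a vertex, none is left.
      have h1 : z.1.length = I.V.card := by rw [← List.toFinset_card_of_nodup h.1, h.2.1]
      have h2 : 0 < 18 * I₁.k ^ 3 * r := by have := I₁.one_le_k; positivity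
      omega
    · exact hc
  obtain ⟨I₂, h₂, hk₂, hy₂, hc₂⟩ := h₁.finish hr hc
  exact ⟨I₂, h₂, hk₂.trans hk₁, hy₂.trans hy₁, hk₁ ▸ hc₂⟩

end Describes
end TestCover

theorem mainTheorem5 (r : ℕ) (hr : 2 ≤ r) :
    ∃ (p : TestCover.Prog) (q : Polynomial ℕ),
      ∀ (I : TestCover.Problem r) (d : TestCover.Data), I.IsCode d →
        ∃ (I' : TestCover.Problem r) (d' : TestCover.Data) (t : ℕ),
          TestCover.Run p d d' t ∧ t ≤ q.eval d.size ∧ I'.IsCode d' ∧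
          I'.k = I.k ∧ (I'.IsYes ↔ I.IsYes) ∧
          I'.V.card ≤ 18 * I.k ^ 3 * r ∧
          I'.E.card ≤ (18 * I.k ^ 3 * r) ^ r := by
  obtain ⟨p, q, hp⟩ := TestCover.PolyTime.kernelize r
  refine ⟨p, q, fun I d hd => ?_⟩
  obtain ⟨z, hz, rfl⟩ := TestCover.isCode_iff.1 hd
  obtain ⟨t, ht, hrun⟩ := hp z
  obtain ⟨I', h', hk, hy, hc⟩ := hz.kernelize (by omega)
  -- The strict bound on the vertices absorbs the `+ 1` in `(|V'| + 1) ^ r`.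
  exact ⟨I', _, t, hrun, ht, TestCover.isCode_iff.2 ⟨_, h', rfl⟩, hk, hy, hc.le,
    (TestCover.card_edges_le I'.edge_subset I'.edge_card_le).trans (Nat.pow_le_pow_left hc r)⟩
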